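/- Let $M\subset\mathbb R^2$ be a compact smooth embedded curve, i.e. a disjoint union of finitely many simple smooth ($C^\infty$) closed curves, with arc length element $dA$, and let $\nu$ be a continuous unit normal field on $M$ (for instance the outward one). For $\operatorname{Re}s>2$ put $N_s(u)=\|u\|^s$ and $$B_{\overline{\overline M}}(s)=T(N_s*T),\qquad T\varphi=\int_M\partial_\nu\varphi\,dA,\qquad (N_s*T)(u)=T\bigl(v\mapsto N_s(v-u)\bigr),$$ so that $B_{\overline{\overline M}}(s)=\int_M\int_M\partial_{\nu_u}\partial_{\nu_v}\|v-u\|^s\,dA(v)\,dA(u)$ is the Brylinski beta function of the uniform double layer on $M$. Let $\kappa_0$ be the curvature of $M$ and $\kappa_n$ the $n$-th derivative of $\kappa_0$ with respect to a unit speed parametrization. Then $B_{\overline{\overline M}}$ has a meromorphic continuation to $\mathbb C$, and its residues at $s=1,-1,-3,-5$ are $$\operatorname{Res}_{s=1}B_{\overline{\overline M}}=-2\,\mathrm{Length}(M),$$ $$\operatorname{Res}_{s=-1}B_{\overline{\overline M}}=\int_M\tfrac34\kappa_0^2\,dA,$$ $$\operatorname{Res}_{s=-3}B_{\overline{\overline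 M}}=\int_M\Bigl(\tfrac{45}{64}\kappa_0^4+\tfrac54\kappa_1^2+\tfrac{15}{8}\kappa_0\kappa_2\Bigr)dA,$$ $$\operatorname{Res}_{s=-5}B_{\overline{\overline M}}=\int_M\Bigl(\tfrac{175}{512}\kappa_0^6+\tfrac{1295}{288}\kappa_0^2\kappa_1^2+\tfrac{1085}{576}\kappa_0^3\kappa_2+\tfrac{175}{576}\kappa_2^2+\tfrac{35}{72}\kappa_1\kappa_3+\tfrac{35}{144}\kappa_0\kappa_4\Bigr)dA.$$ -/

import Mathlib

open Set Filter Topology MeasureTheory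
open scoped ContDiff Real

/-- The Euclidean plane. -/
abbrev Plane : Type := EuclideanSpace ℝ (Fin 2)

/-- A simple (embedded) smooth closed curve in the plane, given by a unit speed parametrization
`γ` of period `L`. The number `L` is the length of the curve. -/
structure SmoothClosedCurve where
  γ : ℝ → Plane
  L : ℝ
  L_pos : 0 < L
  smooth : ContDiff ℝ ∞ γ
  unit_speed : ∀ t, ‖deriv γ t‖ = 1
  periodic : Function.Periodic γ L
  injOn : InjOn γ (Ico 0 L)

namespace SmoothClosedCurve

/-- The set of points of the curve. -/
def support (C : SmoothClosedCurve) : Set Plane := range C.γ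

/-- The integral over the curve, with respect to arc length, of a function of the parameter. -/
noncomputable def arcIntegral {E : Type*} [NormedAddCommGroup E] [NormedSpace ℝ E]
    (C : SmoothClosedCurve) (g : ℝ → E) : E :=
  ∫ t in (0 : ℝ)..C.L, g t

/-- The (signed) curvature `x' y'' - y' x''` of the unit speed curve `γ = (x, y)`. -/
noncomputable def curvature (C : SmoothClosedCurve) (t : ℝ) : ℝ :=
  deriv C.γ t 0 * deriv (deriv C.γ) t 1 - deriv C.γ t 1 * deriv (deriv C.γ) t 0

/-- `κ n` is the `n`-th derivative of the curvature with respect to arc length. -/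
noncomputable def κ (C : SmoothClosedCurve) (n : ℕ) (t : ℝ) : ℝ :=
  iteratedDeriv n C.curvature t

end SmoothClosedCurve

/-- `ν` is a continuous unit normal field along the union of the curves `C i`. If the `C i` are
pairwise disjoint, the outward unit normal field of their union is one such field. -/
structure IsUnitNormalField {ι : Type*} (C : ι → SmoothClosedCurve) (ν : Plane → Plane) :
    Prop where
  continuousOn : ContinuousOn ν (⋃ i, (C i).support)
  norm_eq_one : ∀ i t, ‖ν ((C i).γ t)‖ = 1
  normal : ∀ i t, inner ℝ (ν ((C i).γ t)) (deriv (C i).γ t) = 0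

/-- The uniform double layer on `M = ⋃ i, C i` with unit normal field `ν`: the distribution of
order one `φ ↦ ∫_M ∂_ν φ dA`, as a functional on (continuously differentiable) functions. -/
noncomputable def doubleLayer {ι : Type*} [Fintype ι] (C : ι → SmoothClosedCurve)
    (ν : Plane → Plane) (φ : Plane → ℂ) : ℂ :=
  ∑ i, (C i).arcIntegral fun t => fderiv ℝ φ ((C i).γ t) (ν ((C i).γ t))

/-- The function `N_s(u) = ‖u‖ ^ s`. -/
noncomputable def normPow (s : ℂ) (u : Plane) : ℂ := (‖u‖ : ℂ) ^ s

/-- The Brylinski beta function `B_T(s) = T (N_s * T)`, where `(N_s * T)(u) = T (v ↦ N_s (v - u))`.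
If `T` is a compactly supported distribution of order `k`, this is meaningful for `Re s > 2k`. -/
noncomputable def brylinskiBeta (T : (Plane → ℂ) → ℂ) (s : ℂ) : ℂ :=
  T fun u => T fun v => normPow s (v - u)

/-- `a` is the residue of `F` at the (at most isolated) singularity `z`: the integral of `F` over
every sufficiently small circle around `z`, divided by `2πi`, equals `a`. -/
def HasResidue (F : ℂ → ℂ) (z a : ℂ) : Prop :=
  ∀ᶠ r in 𝓝[>] (0 : ℝ), (2 * (π : ℂ) * Complex.I)⁻¹ * (∮ w in C(z, r), F w) = a

/-! For `Re s > 2` the kernel `‖v - u‖ ^ s` can be differentiated once in each variable, even across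
the diagonal, and the derivative taken under the integral. The beta function is then the sum over
pairs of components of the double integrals of `layerKernel` (`brylinskiBeta_doubleLayer`). Two
distinct components never meet, so their interaction is entire in `s`
(`differentiable_layerIntegral`) and affects no residue. Along one component `ν` is a constant sign
times the rotated tangent (`IsUnitNormalField.exists_sign`); the sign cancels because the kernel is
linear in each normal.

For the self-interaction put `u = γ t`, `v = γ (t + h)`. Periodicity and symmetry fold the torus of
parameters onto `0 ≤ h ≤ L / 2` with a factor 2 (`integral_periodic_symmetric_kernel`), so that `h =
0` is the only singular place. In the orthonormal frame at `t` the tangent at `t + h` is `(A, h B)`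
and the chord is `(h X, h² Y)`, with `A`, `B`, `X`, `Y` smooth by Hadamard's lemma. With `Q = X² +
h² Y²` the kernel equals `h^(s-2) f`, where `f = -(s A Q^((s-2)/2) + s (s-2) h² Y (A Y - B X)
Q^((s-4)/2))`. Embeddedness keeps `Q` positive for `|h| < L`, so `f` is smooth there and entire in
`s` (`exists_smooth_factor`).

After integration in `t` a Mellin integral `∫ h^(s-2) Φ(s, h) dh` remains. Repeated integration by
parts continues it meromorphically, and its residue at `s = 1 - k` is the coefficient of `h^k` in
`Φ(1 - k, ·)` (`exists_meromorphic_mellin`). The residues sought are therefore twice the integrals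
over `t` of the Taylor coefficients of `f` of orders 0, 2, 4, 6 at `s = 1, -1, -3, -5`. The Frenet
equations and the equation `Q V' = p Q' V` for `V = Q^p` give recursions that express these
coefficients through the derivatives of the curvature (`kernel_coeff`). -/

/-! ### Integrals depending on a parameter: continuity, derivatives, holomorphy, smoothness. -/

section ParametricIntegrals

theorem continuousOn_intervalIntegral_of_continuousOn {X E : Type*} [TopologicalSpace X]
    [NormedAddCommGroup E] [NormedSpace ℝ E] {S : Set X} {f : X → ℝ → E} {a b : ℝ}
    (hf : ContinuousOn (Function.uncurry f) (S ×ˢ uIcc a b)) :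
    ContinuousOn (fun x => ∫ t in a..b, f x t) S := by
  rw [continuousOn_iff_continuous_domRestrict]
  have hle : min a b ≤ max a b := min_le_max
  -- Clamping `t` to the interval turns continuity on a product set into global continuity without
  -- changing the integral.
  have hcont : Continuous (Function.uncurry fun (x : S) (t : ℝ) =>
      f x (projIcc (min a b) (max a b) hle t)) := by
    refine hf.comp_continuous (f := fun p : S × ℝ =>
      ((p.1 : X), (projIcc (min a b) (max a b) hle p.2 : ℝ))) (by fun_prop) ?_
    intro p
    exact ⟨p.1.2, (projIcc (min a b) (max a b) hle p.2).2⟩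
  have := intervalIntegral.continuous_parametric_intervalIntegral_of_continuous'
    (μ := volume) hcont a b
  refine this.congr fun x => ?_
  refine intervalIntegral.integral_congr fun t ht => ?_
  exact congrArg (fun y : Icc (min a b) (max a b) => f x y) (projIcc_of_mem hle ht)

/-- Compactness of the interval (a tube argument) makes the bound uniform in `t`. It supplies the
constant dominating function in the differentiation lemmas. -/
theorem exists_nhds_norm_le_of_continuousOn {X E : Type*} [TopologicalSpace X]
    [NormedAddCommGroup E] {U : Set X} (hU : IsOpen U) {f : X → ℝ → E} {a b : ℝ}
    (hf : ContinuousOn (Function.uncurry f) (U ×ˢ uIcc a b)) {x₀ : X} (hx₀ : x₀ ∈ U) :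
    ∃ M : ℝ, ∀ᶠ x in 𝓝 x₀, ∀ t ∈ uIcc a b, ‖f x t‖ ≤ M := by
  have hslice : ContinuousOn (fun t => f x₀ t) (uIcc a b) :=
    hf.comp (f := fun t => (x₀, t)) (by fun_prop) fun t ht => ⟨hx₀, ht⟩
  obtain ⟨M, hM⟩ := (isCompact_uIcc (a := a) (b := b)).exists_bound_of_continuousOn hslice
  refine ⟨M + 1, ?_⟩
  have key : ∀ᶠ x in 𝓝 x₀, ∀ t ∈ uIcc a b, t ∈ uIcc a b → ‖f x t‖ ≤ M + 1 := by
    refine isCompact_uIcc.eventually_forall_of_forall_eventually fun t ht => ?_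
    have h1 := (hf (x₀, t) ⟨hx₀, ht⟩).norm
    have h2 : ∀ᶠ z in 𝓝[U ×ˢ uIcc a b] (x₀, t), ‖Function.uncurry f z‖ < M + 1 :=
      h1.eventually (gt_mem_nhds (lt_of_le_of_lt (hM t ht) (lt_add_one M)))
    rw [eventually_nhdsWithin_iff] at h2
    have h3 : ∀ᶠ z : X × ℝ in 𝓝 (x₀, t), z.1 ∈ U :=
      continuous_fst.continuousAt.eventually (hU.mem_nhds hx₀)
    filter_upwards [h2, h3] with z hz hz' hzt
    exact (hz ⟨hz', hzt⟩).le
  exact key.mono fun x hx t ht => hx t ht ht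

theorem hasFDerivAt_intervalIntegral_of_continuousOn {𝕜 H E : Type*} [RCLike 𝕜]
    [NormedAddCommGroup H] [NormedSpace 𝕜 H] [NormedAddCommGroup E] [NormedSpace ℝ E]
    [NormedSpace 𝕜 E] {U : Set H} (hU : IsOpen U)
    {f : H → ℝ → E} {f' : H → ℝ → H →L[𝕜] E} {a b : ℝ}
    (hf : ∀ x ∈ U, ContinuousOn (f x) (uIcc a b))
    (hf' : ContinuousOn (Function.uncurry f') (U ×ˢ uIcc a b))
    (hd : ∀ x ∈ U, ∀ t ∈ uIcc a b, HasFDerivAt (fun y => f y t) (f' x t) x)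
    {x₀ : H} (hx₀ : x₀ ∈ U) :
    HasFDerivAt (fun x => ∫ t in a..b, f x t) (∫ t in a..b, f' x₀ t) x₀ := by
  obtain ⟨M, hM⟩ := exists_nhds_norm_le_of_continuousOn hU hf' hx₀
  have hs := Filter.inter_mem hM (hU.mem_nhds hx₀)
  have hslice : ContinuousOn (fun t => f' x₀ t) (uIcc a b) :=
    hf'.comp (f := fun t => (x₀, t)) (by fun_prop) fun t ht => ⟨hx₀, ht⟩
  refine intervalIntegral.hasFDerivAt_integral_of_dominated_of_fderiv_le (bound := fun _ => M)
    (F' := f') hs ?_ (hf x₀ hx₀).intervalIntegrable ?_ ?_ intervalIntegrable_const ?_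
  · filter_upwards [hU.mem_nhds hx₀] with x hx
    exact (intervalIntegrable_iff.1 (hf x hx).intervalIntegrable).aestronglyMeasurable
  · exact (intervalIntegrable_iff.1 hslice.intervalIntegrable).aestronglyMeasurable
  · exact Eventually.of_forall fun t ht x hx => hx.1 t (uIoc_subset_uIcc ht)
  · exact Eventually.of_forall fun t ht x hx => hd x hx.2 t (uIoc_subset_uIcc ht)

theorem hasDerivAt_intervalIntegral_of_continuousOn {𝕜 E : Type*} [RCLike 𝕜]
    [NormedAddCommGroup E] [NormedSpace ℝ E]
    [NormedSpace 𝕜 E] {U : Set 𝕜} (hU : IsOpen U)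
    {f f' : 𝕜 → ℝ → E} {a b : ℝ}
    (hf : ∀ x ∈ U, ContinuousOn (f x) (uIcc a b))
    (hf' : ContinuousOn (Function.uncurry f') (U ×ˢ uIcc a b))
    (hd : ∀ x ∈ U, ∀ t ∈ uIcc a b, HasDerivAt (fun y => f y t) (f' x t) x)
    {x₀ : 𝕜} (hx₀ : x₀ ∈ U) :
    HasDerivAt (fun x => ∫ t in a..b, f x t) (∫ t in a..b, f' x₀ t) x₀ := by
  obtain ⟨M, hM⟩ := exists_nhds_norm_le_of_continuousOn hU hf' hx₀
  have hs := Filter.inter_mem hM (hU.mem_nhds hx₀)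
  have hslice : ContinuousOn (fun t => f' x₀ t) (uIcc a b) :=
    hf'.comp (f := fun t => (x₀, t)) (by fun_prop) fun t ht => ⟨hx₀, ht⟩
  refine (intervalIntegral.hasDerivAt_integral_of_dominated_loc_of_deriv_le
    (bound := fun _ => M)
    (F' := f') hs ?_ (hf x₀ hx₀).intervalIntegrable ?_ ?_ intervalIntegrable_const ?_).2
  · filter_upwards [hU.mem_nhds hx₀] with x hx
    exact (intervalIntegrable_iff.1 (hf x hx).intervalIntegrable).aestronglyMeasurable
  · exact (intervalIntegrable_iff.1 hslice.intervalIntegrable).aestronglyMeasurable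
  · exact Eventually.of_forall fun t ht x hx => hx.1 t (uIoc_subset_uIcc ht)
  · exact Eventually.of_forall fun t ht x hx => hd x hx.2 t (uIoc_subset_uIcc ht)

/-- No continuity of the `s`-derivative is assumed: Cauchy's estimate on a disc dominates it by a
bound for `f` itself, and it is measurable in `t` as a limit of difference quotients. -/
theorem differentiableOn_intervalIntegral_of_continuousOn {U : Set ℂ} (hU : IsOpen U)
    {f : ℂ → ℝ → ℂ} {a b : ℝ} (hf : ContinuousOn (Function.uncurry f) (U ×ˢ uIcc a b))
    (hd : ∀ t ∈ uIcc a b, DifferentiableOn ℂ (fun s => f s t) U) :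
    DifferentiableOn ℂ (fun s => ∫ t in a..b, f s t) U := by
  intro s₀ hs₀
  have hslice : ∀ s ∈ U, ContinuousOn (fun t => f s t) (uIcc a b) := fun s hs =>
    hf.comp (f := fun t => (s, t)) (by fun_prop) fun t ht => ⟨hs, ht⟩
  obtain ⟨M, hM⟩ := exists_nhds_norm_le_of_continuousOn hU hf hs₀
  obtain ⟨r, hr, hball⟩ := Metric.mem_nhds_iff.1 (Filter.inter_mem hM (hU.mem_nhds hs₀))
  have hmeas : AEStronglyMeasurable (fun t => deriv (fun s => f s t) s₀)
      (volume.restrict (uIoc a b)) := by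
    -- A sequence in the disc that tends to `s₀` and avoids it, along which the slopes converge to
    -- the derivative.
    have hseq : Tendsto (fun n : ℕ => s₀ + ((r / 2 / (n + 1 : ℝ) : ℝ) : ℂ)) atTop (𝓝[≠] s₀) := by
      rw [tendsto_nhdsWithin_iff]
      constructor
      · have h0 : Tendsto (fun n : ℕ => (r / 2 / (n + 1 : ℝ) : ℝ)) atTop (𝓝 0) := by
          have := (tendsto_one_div_add_atTop_nhds_zero_nat (𝕜 := ℝ)).const_mul (r / 2)
          simpa [div_eq_mul_inv] using this
        have h1 := (Complex.continuous_ofReal.tendsto 0).comp h0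
        simpa using h1.const_add s₀
      · refine Eventually.of_forall fun n => ?_
        have : (0 : ℝ) < r / 2 / (n + 1 : ℝ) := by positivity
        simp only [mem_compl_iff, mem_singleton_iff, add_eq_left, Complex.ofReal_eq_zero]
        exact this.ne'
    refine aestronglyMeasurable_of_tendsto_ae atTop
      (f := fun n : ℕ => fun t => slope (fun s => f s t) s₀
        (s₀ + ((r / 2 / (n + 1 : ℝ) : ℝ) : ℂ))) (fun n => ?_) ?_
    · have hmem : s₀ + ((r / 2 / (n + 1 : ℝ) : ℝ) : ℂ) ∈ U := by
        refine (hball ?_).2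
        have h2 : (0 : ℝ) < r / 2 / (n + 1 : ℝ) := by positivity
        have h3 : r / 2 / (n + 1 : ℝ) ≤ r / 2 :=
          div_le_self (by positivity) (by linarith [Nat.cast_nonneg (α := ℝ) n])
        rw [Metric.mem_ball, dist_eq_norm, add_sub_cancel_left, Complex.norm_real,
          Real.norm_of_nonneg h2.le]
        linarith
      have : ContinuousOn (fun t => slope (fun s => f s t) s₀
          (s₀ + ((r / 2 / (n + 1 : ℝ) : ℝ) : ℂ))) (uIcc a b) := by
        simp only [slope_def_field]
        exact ((hslice _ hmem).sub (hslice _ hs₀)).div_const _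
      exact (intervalIntegrable_iff.1 this.intervalIntegrable).aestronglyMeasurable
    · refine (ae_restrict_iff' measurableSet_uIoc).2 (Eventually.of_forall fun t ht => ?_)
      have hdt := ((hd t (uIoc_subset_uIcc ht)).differentiableAt (hU.mem_nhds hs₀)).hasDerivAt
      exact (hasDerivAt_iff_tendsto_slope.1 hdt).comp hseq
  have hr2 : Metric.ball s₀ (r / 2) ∈ 𝓝 s₀ := Metric.ball_mem_nhds _ (by positivity)
  refine ((intervalIntegral.hasDerivAt_integral_of_dominated_loc_of_deriv_le
    (bound := fun _ => M / (r / 2)) (F' := fun s t => deriv (fun s => f s t) s) hr2 ?_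
    (hslice s₀ hs₀).intervalIntegrable hmeas ?_ intervalIntegrable_const
      ?_).2).differentiableAt.differentiableWithinAt
  · filter_upwards [hU.mem_nhds hs₀] with x hx
    exact (intervalIntegrable_iff.1 (hslice x hx).intervalIntegrable).aestronglyMeasurable
  · refine Eventually.of_forall fun t ht s hs => ?_
    have hsub : Metric.closedBall s (r / 2 / 1) ⊆ Metric.ball s₀ r := by
      intro z hz
      rw [Metric.mem_closedBall] at hz
      rw [Metric.mem_ball] at hs ⊢
      linarith [dist_triangle z s s₀]
    have hsub' : Metric.closedBall s (r / 2) ⊆ Metric.ball s₀ r := by simpa using hsub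
    refine Complex.norm_deriv_le_of_forall_mem_sphere_norm_le (by positivity) ?_ ?_
    · refine ((hd t (uIoc_subset_uIcc ht)).mono ?_).diffContOnCl_ball
        (U := Metric.ball s₀ r) hsub'
      exact fun z hz => (hball hz).2
    · intro z hz
      exact (hball (hsub' (Metric.sphere_subset_closedBall hz))).1 t (uIoc_subset_uIcc ht)
  · refine Eventually.of_forall fun t ht s hs => ?_
    have hsU : s ∈ U := (hball (Metric.ball_subset_ball (by linarith) hs)).2
    exact ((hd t (uIoc_subset_uIcc ht)).differentiableAt (hU.mem_nhds hsU)).hasDerivAt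

/-- The target space is quantified inside the induction because the derivative takes values in `E
→L[ℝ] F`; keeping both spaces in `Type` keeps that space in the same universe. -/
theorem contDiff_nat_intervalIntegral {E : Type} [NormedAddCommGroup E] [NormedSpace ℝ E]
    (a b : ℝ) (n : ℕ) : ∀ {F : Type} [NormedAddCommGroup F] [NormedSpace ℝ F]
    {g : E × ℝ → F}, ContDiff ℝ n g → ContDiff ℝ n (fun x => ∫ t in a..b, g (x, t)) := by
  induction n with
  | zero =>
    intro F _ _ g hg
    have hg' : Continuous g := hg.continuous
    have : Continuous (Function.uncurry fun (x : E) (t : ℝ) => g (x, t)) := hg'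
    simpa using intervalIntegral.continuous_parametric_intervalIntegral_of_continuous'
      (μ := volume) this a b
  | succ n ih =>
    intro F _ _ g hg
    push_cast at hg ⊢
    rw [contDiff_succ_iff_hasFDerivAt]
    refine ⟨fun x => ∫ t in a..b,
      (fderiv ℝ g (x, t)).comp (ContinuousLinearMap.inl ℝ E ℝ), ?_, fun x => ?_⟩
    · refine ih (g := fun p : E × ℝ => (fderiv ℝ g p).comp (ContinuousLinearMap.inl ℝ E ℝ)) ?_
      exact (hg.fderiv_right le_rfl).clm_comp contDiff_const
    · have hd : Differentiable ℝ g := hg.differentiable (by simp)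
      have hc : Continuous (fderiv ℝ g) := hg.continuous_fderiv (by simp)
      refine hasFDerivAt_intervalIntegral_of_continuousOn isOpen_univ
        (f := fun x t => g (x, t))
        (f' := fun x t => (fderiv ℝ g (x, t)).comp (ContinuousLinearMap.inl ℝ E ℝ)) ?_ ?_ ?_
        (mem_univ x)
      · intro x _
        exact (hd.continuous.comp (by fun_prop)).continuousOn
      · refine Continuous.continuousOn ?_
        exact (hc.comp (by fun_prop)).clm_comp continuous_const
      · intro x _ t _
        exact (hd (x, t)).hasFDerivAt.comp x (hasFDerivAt_prodMk_left x t)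

theorem contDiff_intervalIntegral {E F : Type} [NormedAddCommGroup E] [NormedSpace ℝ E]
    [NormedAddCommGroup F] [NormedSpace ℝ F] (a b : ℝ)
    {g : E × ℝ → F} (hg : ContDiff ℝ ∞ g) : ContDiff ℝ ∞ (fun x => ∫ t in a..b, g (x, t)) :=
  contDiff_infty.2 fun n => contDiff_nat_intervalIntegral a b n (hg.of_le (by exact_mod_cast le_top))

/-- Hadamard's lemma: a smooth function that vanishes on `h = 0` is a smooth multiple of `h`. -/
theorem exists_contDiff_eq_mul {φ : ℝ × ℝ → ℝ} (hφ : ContDiff ℝ ∞ φ) (h0 : ∀ t, φ (t, 0) = 0) :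
    ∃ ψ : ℝ × ℝ → ℝ, ContDiff ℝ ∞ ψ ∧ ∀ t h, φ (t, h) = h * ψ (t, h) := by
  -- The quotient is the mean of `∂φ/∂h` over the segment from `(t, 0)` to `(t, h)`, which is smooth
  -- also at `h = 0`.
  refine ⟨fun p => ∫ τ in (0 : ℝ)..1, fderiv ℝ φ (p.1, τ * p.2) (0, 1), ?_, fun t h => ?_⟩
  · refine contDiff_intervalIntegral 0 1
      (g := fun q : (ℝ × ℝ) × ℝ => fderiv ℝ φ (q.1.1, q.2 * q.1.2) (0, 1)) ?_
    have h1 : ContDiff ℝ ∞ (fderiv ℝ φ) := hφ.fderiv_right (by simp)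
    exact (h1.comp (by fun_prop)).clm_apply contDiff_const
  · have hd : Differentiable ℝ φ := hφ.differentiable (by simp)
    have hderiv : ∀ τ ∈ uIcc (0 : ℝ) 1, HasDerivAt (fun τ : ℝ => φ (t, τ * h))
        (fderiv ℝ φ (t, τ * h) (0, 1) * h) τ := by
      intro τ _
      have h2 : HasDerivAt (fun τ : ℝ => (t, τ * h)) ((0 : ℝ), h) τ :=
        (hasDerivAt_const τ t).prodMk (by simpa using (hasDerivAt_id τ).mul_const h)
      have h3 := (hd (t, τ * h)).hasFDerivAt.comp_hasDerivAt τ h2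
      have h4 : ((0 : ℝ), h) = h • ((0 : ℝ), (1 : ℝ)) := by simp
      rw [h4, map_smul, smul_eq_mul, mul_comm] at h3
      exact h3
    have hcont : Continuous (fun τ : ℝ => fderiv ℝ φ (t, τ * h) (0, 1) * h) := by
      have h1 : Continuous (fderiv ℝ φ) := hφ.continuous_fderiv (by simp)
      exact ((h1.comp (by fun_prop)).clm_apply continuous_const).mul continuous_const
    have := intervalIntegral.integral_eq_sub_of_hasDerivAt hderiv (hcont.intervalIntegrable 0 1)
    rw [intervalIntegral.integral_mul_const] at this
    simp only [one_mul, zero_mul, h0, sub_zero] at this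
    rw [← this, mul_comm]

end ParametricIntegrals

/-! ### Singularities that are at most simple poles, and their residues. -/

section SimplePoles

/-- Near `z`, away from `z`, `F` is the sum of `c / (s - z)` and an analytic function. -/
def HasSimplePart (F : ℂ → ℂ) (z c : ℂ) : Prop :=
  ∃ g : ℂ → ℂ, AnalyticAt ℂ g z ∧ ∀ᶠ s in 𝓝[≠] z, F s = c / (s - z) + g s

theorem AnalyticAt.hasSimplePart {F : ℂ → ℂ} {z : ℂ} (hF : AnalyticAt ℂ F z) :
    HasSimplePart F z 0 :=
  ⟨F, hF, by simp⟩

theorem HasSimplePart.add {F G : ℂ → ℂ} {z c d : ℂ} (hF : HasSimplePart F z c)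
    (hG : HasSimplePart G z d) : HasSimplePart (fun s => F s + G s) z (c + d) := by
  obtain ⟨f, hf, hf'⟩ := hF
  obtain ⟨g, hg, hg'⟩ := hG
  refine ⟨fun s => f s + g s, hf.add hg, ?_⟩
  filter_upwards [hf', hg'] with s h1 h2
  rw [h1, h2]
  ring

theorem HasSimplePart.sum {α : Type*} (S : Finset α) {F : α → ℂ → ℂ} {z : ℂ} {c : α → ℂ}
    (hF : ∀ i ∈ S, HasSimplePart (F i) z (c i)) :
    HasSimplePart (fun s => ∑ i ∈ S, F i s) z (∑ i ∈ S, c i) := by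
  classical
  induction S using Finset.induction_on with
  | empty => simpa using (analyticAt_const (𝕜 := ℂ) (v := (0 : ℂ)) (x := z)).hasSimplePart
  | insert i S hi ih =>
    simp only [Finset.sum_insert hi]
    exact (hF i (Finset.mem_insert_self i S)).add
      (ih fun j hj => hF j (Finset.mem_insert_of_mem hj))

theorem HasSimplePart.const_mul {F : ℂ → ℂ} {z c : ℂ} (hF : HasSimplePart F z c) (d : ℂ) :
    HasSimplePart (fun s => d * F s) z (d * c) := by
  obtain ⟨f, hf, hf'⟩ := hF
  refine ⟨fun s => d * f s, analyticAt_const.mul hf, ?_⟩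
  filter_upwards [hf'] with s h1
  rw [h1]
  ring

/-- Splitting `H s = H z + (s - z) * dslope H z s` leaves the pole with coefficient `H z`, since the
divided slope of an analytic function is analytic. -/
theorem HasSimplePart.of_analytic_div {F G H : ℂ → ℂ} {z : ℂ} (hG : AnalyticAt ℂ G z)
    (hH : AnalyticAt ℂ H z) (hF : ∀ᶠ s in 𝓝[≠] z, F s = G s + H s / (s - z)) :
    HasSimplePart F z (H z) := by
  obtain ⟨p, hp⟩ := hH
  refine ⟨fun s => G s + dslope H z s, hG.add hp.has_fpower_series_dslope_fslope.analyticAt, ?_⟩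
  filter_upwards [hF, self_mem_nhdsWithin] with s hs hne
  have hne' : s - z ≠ 0 := sub_ne_zero.2 hne
  rw [hs, dslope_of_ne _ hne, slope_def_field]
  field_simp
  ring

theorem HasSimplePart.hasResidue {F : ℂ → ℂ} {z c : ℂ} (hF : HasSimplePart F z c) :
    HasResidue F z c := by
  obtain ⟨g, hg, hF⟩ := hF
  obtain ⟨r, hr, hball⟩ := Metric.mem_nhds_iff.1
    (Filter.inter_mem hg.eventually_analyticAt (eventually_nhdsWithin_iff.1 hF))
  filter_upwards [Ioo_mem_nhdsGT hr] with ρ hρ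
  have hsub : Metric.closedBall z ρ ⊆ Metric.ball z r := Metric.closedBall_subset_ball hρ.2
  have hgd : DifferentiableOn ℂ g (Metric.ball z r) := fun s hs =>
    ((hball hs).1 : AnalyticAt ℂ g s).differentiableAt.differentiableWithinAt
  have h1 : (∮ w in C(z, ρ), F w) = ∮ w in C(z, ρ), (c * (w - z)⁻¹ + g w) := by
    refine circleIntegral.integral_congr hρ.1.le fun w hw => ?_
    have hne : w ≠ z := by
      rintro rfl
      simp only [mem_sphere_iff_norm, sub_self, norm_zero] at hw
      exact hρ.1.ne hw
    have := (hball (hsub (Metric.sphere_subset_closedBall hw))).2 hne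
    simpa [div_eq_mul_inv] using this
  have hzero : (∮ w in C(z, ρ), g w) = 0 :=
    (hgd.diffContOnCl_ball hsub).circleIntegral_eq_zero hρ.1.le
  have hi1 : CircleIntegrable (fun w => c * (w - z)⁻¹) z ρ := by
    refine ContinuousOn.circleIntegrable hρ.1.le ?_
    refine continuousOn_const.mul (ContinuousOn.inv₀ (by fun_prop) fun w hw => ?_)
    intro h0
    rw [sub_eq_zero] at h0
    subst h0
    simp only [mem_sphere_iff_norm, sub_self, norm_zero] at hw
    exact hρ.1.ne hw
  have hi2 : CircleIntegrable g z ρ :=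
    ContinuousOn.circleIntegrable hρ.1.le
      (hgd.continuousOn.mono (Metric.sphere_subset_closedBall.trans hsub))
  rw [h1, circleIntegral.integral_add hi1 hi2, hzero, circleIntegral.integral_const_mul,
    circleIntegral.integral_sub_center_inv _ hρ.1.ne']
  have : (2 * (π : ℂ) * Complex.I) ≠ 0 := Complex.two_pi_I_ne_zero
  rw [add_zero, mul_comm c, inv_mul_cancel_left₀ this]

end SimplePoles

/-! ### Continuation of Mellin integrals by repeated integration by parts. -/

section Mellin

/-- A sequence of functions of `(s, h)`, each the `h`-derivative of the previous one,
jointly continuous and entire in `s`. -/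
structure IsHolomorphicJet (L : ℝ) (D : ℕ → ℂ → ℝ → ℂ) : Prop where
  continuousOn : ∀ k, ContinuousOn (Function.uncurry (D k)) (univ ×ˢ Ioo (-L) L)
  differentiable : ∀ k, ∀ h ∈ Ioo (-L) L, Differentiable ℂ fun s => D k s h
  hasDerivAt : ∀ k s, ∀ h ∈ Ioo (-L) L, HasDerivAt (D k s) (D (k + 1) s h) h

/-- The Mellin type integral `∫₀ᵃ h^(s-2+N) D N s h dh`. -/
noncomputable def mellinTail (D : ℕ → ℂ → ℝ → ℂ) (a : ℝ) (N : ℕ) (s : ℂ) : ℂ :=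
  ∫ h in (0 : ℝ)..a, (h : ℂ) ^ (s - 2 + N) * D N s h

/-- The product `(s - 1) s ⋯ (s - 2 + N)`. -/
noncomputable def poleProd (N : ℕ) (s : ℂ) : ℂ := ∏ k ∈ Finset.range N, (s - 1 + k)

/-- The continuation, to `2 - N < Re s`, of `∫₀ᵃ h^(s-2) D 0 s h dh` by `N` integrations by
parts. -/
noncomputable def mellinCont (D : ℕ → ℂ → ℝ → ℂ) (a : ℝ) (N : ℕ) (s : ℂ) : ℂ :=
  ∑ k ∈ Finset.range N, (-1) ^ k * (a : ℂ) ^ (s - 1 + k) * D k s a / poleProd (k + 1) s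
    + (-1) ^ N / poleProd N s * mellinTail D a N s

theorem poleProd_succ (N : ℕ) (s : ℂ) : poleProd (N + 1) s = poleProd N s * (s - 1 + N) :=
  Finset.prod_range_succ _ _

/-- The factor of index `j` is `j - k`. This is the source of the `1 / k!` in the residue. -/
theorem poleProd_one_sub (k : ℕ) : poleProd k (1 - k) = (-1) ^ k * (k.factorial : ℂ) := by
  have h : poleProd k (1 - k) = ∏ j ∈ Finset.range k, (-1 * ((k - 1 - j : ℕ) + 1 : ℂ)) := by
    refine Finset.prod_congr rfl fun j hj => ?_
    have hj' : j + 1 ≤ k := Finset.mem_range.1 hj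
    rw [Nat.sub_sub, add_comm 1 j, Nat.cast_sub hj']
    push_cast
    ring
  rw [h, Finset.prod_mul_distrib, Finset.prod_const, Finset.card_range,
    Finset.prod_range_reflect (fun j => ((j : ℂ) + 1)) k]
  congr 1
  rw [← Finset.prod_range_add_one_eq_factorial]
  push_cast
  rfl

theorem differentiable_poleProd (N : ℕ) : Differentiable ℂ (poleProd N) := by
  unfold poleProd
  fun_prop

variable {L a : ℝ} {D : ℕ → ℂ → ℝ → ℂ}

theorem IsHolomorphicJet.continuousOn_slice (hD : IsHolomorphicJet L D) (ha : 0 < a) (haL : a < L)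
    (k : ℕ) (s : ℂ) : ContinuousOn (D k s) (uIcc 0 a) := by
  refine (hD.continuousOn k).comp (f := fun h => (s, h)) (by fun_prop) fun h hh => ?_
  rw [uIcc_of_le ha.le] at hh
  exact ⟨mem_univ _, by linarith [hh.1], by linarith [hh.2]⟩

/-- One integration by parts; the boundary term at 0 vanishes because `h^(s-1+N)` does. Continuity
of the lower power is a hypothesis of its own, so that the case of exponent exactly 0, needed for
the residue, is included. -/
theorem mellinTail_eq (hD : IsHolomorphicJet L D) (ha : 0 < a) (haL : a < L) (N : ℕ) {s : ℂ}
    (hc : Continuous fun h : ℝ => (h : ℂ) ^ (s - 2 + N)) (hre' : 0 < (s - 1 + N).re) :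
    (s - 1 + N) * mellinTail D a N s =
      (a : ℂ) ^ (s - 1 + N) * D N s a - mellinTail D a (N + 1) s := by
  have hne : s - 1 + N ≠ 0 := fun h => by simp [h] at hre'
  have hmem : ∀ x ∈ Ioo (min 0 a) (max 0 a), x ∈ Ioo (-L) L ∧ 0 < x := by
    intro x hx
    rw [min_eq_left ha.le, max_eq_right ha.le] at hx
    exact ⟨⟨by linarith [hx.1], by linarith [hx.2]⟩, hx.1⟩
  have key := intervalIntegral.integral_deriv_mul_eq_sub_of_hasDerivAt (a := 0) (b := a)
    (u := fun h : ℝ => (h : ℂ) ^ (s - 1 + N)) (v := D N s)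
    (u' := fun h : ℝ => (s - 1 + N) * (h : ℂ) ^ (s - 2 + N)) (v' := D (N + 1) s)
    (Complex.continuous_ofReal_cpow_const hre').continuousOn
    (hD.continuousOn_slice ha haL N s) ?_
    (fun x hx => hD.hasDerivAt N s x (hmem x hx).1) ?_
    (hD.continuousOn_slice ha haL (N + 1) s).intervalIntegrable
  · rw [intervalIntegral.integral_add] at key
    · have e1 : ∫ x in (0 : ℝ)..a, (s - 1 + N) * (x : ℂ) ^ (s - 2 + N) * D N s x =
          (s - 1 + N) * mellinTail D a N s := by
        rw [mellinTail, ← intervalIntegral.integral_const_mul]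
        simp only [mul_assoc]
      have e2 : ∫ x in (0 : ℝ)..a, (x : ℂ) ^ (s - 1 + N) * D (N + 1) s x =
          mellinTail D a (N + 1) s := by
        have : s - 1 + N = s - 2 + (N + 1 : ℕ) := by push_cast; ring
        rw [mellinTail, this]
      rw [e1, e2] at key
      simp only [Complex.ofReal_zero, Complex.zero_cpow hne, zero_mul, sub_zero] at key
      rw [← key]
      ring
    · exact ((continuous_const.mul hc).continuousOn.mul
        (hD.continuousOn_slice ha haL N s)).intervalIntegrable
    · exact ((Complex.continuous_ofReal_cpow_const hre').continuousOn.mul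
        (hD.continuousOn_slice ha haL (N + 1) s)).intervalIntegrable
  · intro x hx
    have h1 := hasDerivAt_ofReal_cpow_const' (x := x) (hmem x hx).2.ne' (r := s - 2 + N)
      (fun h => hne (by linear_combination h))
    have h2 := h1.const_mul (s - 1 + N)
    have e : s - 2 + N + 1 = s - 1 + N := by ring
    rw [e] at h2
    refine h2.congr_of_eventuallyEq (Eventually.of_forall fun y => ?_)
    simp only
    rw [mul_div_cancel₀ _ hne]
  · exact (continuous_const.mul hc).intervalIntegrable _ _

theorem mellinCont_succ (hD : IsHolomorphicJet L D) (ha : 0 < a) (haL : a < L) (N : ℕ) {s : ℂ}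
    (hs : 2 - N < s.re) : mellinCont D a (N + 1) s = mellinCont D a N s := by
  have hre' : 0 < (s - 1 + N).re := by simp; linarith
  have hne : s - 1 + N ≠ 0 := fun h => by simp [h] at hre'
  have hre : 0 < (s - 2 + N).re := by simp; linarith
  have h := mellinTail_eq hD ha haL N (Complex.continuous_ofReal_cpow_const hre) hre'
  have h' : mellinTail D a N s = ((a : ℂ) ^ (s - 1 + N) * D N s a - mellinTail D a (N + 1) s)
      / (s - 1 + N) := by
    rw [eq_div_iff hne, mul_comm]
    exact h
  rw [mellinCont, mellinCont, Finset.sum_range_succ, h', poleProd_succ, pow_succ, add_assoc]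
  congr 1
  -- The half plane may contain zeros of the earlier factors. There division by zero makes the terms
  -- compared here vanish, so the two continuations agree at poles too.
  by_cases hp : poleProd N s = 0
  · simp [hp]
  · field_simp
    ring

theorem mellinCont_eq_of_le (hD : IsHolomorphicJet L D) (ha : 0 < a) (haL : a < L) {N M : ℕ}
    (hNM : N ≤ M) {s : ℂ} (hs : 2 - N < s.re) : mellinCont D a M s = mellinCont D a N s := by
  induction M, hNM using Nat.le_induction with
  | base => rfl
  | succ M hNM ih =>
    rw [mellinCont_succ hD ha haL M, ih]
    have : (N : ℝ) ≤ M := by exact_mod_cast hNM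
    linarith

/-- The half plane is where `h^(s-2+N)` has exponent of positive real part, so the integrand is
jointly continuous up to `h = 0` and no improper integral arises. -/
theorem differentiableOn_mellinTail (hD : IsHolomorphicJet L D) (ha : 0 < a) (haL : a < L)
    (N : ℕ) : DifferentiableOn ℂ (mellinTail D a N) {s | 2 - N < s.re} := by
  have hU : IsOpen {s : ℂ | 2 - N < s.re} := isOpen_lt continuous_const Complex.continuous_re
  have hmem : ∀ x ∈ uIcc 0 a, x ∈ Ioo (-L) L := by
    intro x hx
    rw [uIcc_of_le ha.le] at hx
    exact ⟨by linarith [hx.1], by linarith [hx.2]⟩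
  have hre : ∀ s ∈ {s : ℂ | 2 - N < s.re}, 0 < (s - 2 + N).re := fun s hs => by
    have : 2 - (N : ℝ) < s.re := hs
    simp; linarith
  refine differentiableOn_intervalIntegral_of_continuousOn hU ?_ fun t ht => ?_
  · refine ContinuousOn.mul ?_ ((hD.continuousOn N).mono ?_)
    · rintro ⟨s, h⟩ ⟨hs, hh⟩
      have h1 := Complex.continuousAt_ofReal_cpow h (s - 2 + N) (Or.inl (hre s hs))
      have h2 : ContinuousAt (fun p : ℂ × ℝ => (p.2, p.1 - 2 + N)) (s, h) := by fun_prop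
      exact (ContinuousAt.comp (f := fun p : ℂ × ℝ => (p.2, p.1 - 2 + N)) h1 h2).continuousWithinAt
    · rintro ⟨s, h⟩ ⟨_, hh⟩
      exact ⟨mem_univ _, hmem h hh⟩
  · refine DifferentiableOn.mul ?_ (hD.differentiable N t (hmem t ht)).differentiableOn
    intro s hs
    refine (DifferentiableAt.const_cpow (by fun_prop) (Or.inr fun h0 => ?_)).differentiableWithinAt
    have := hre s hs
    rw [h0] at this
    simp at this

theorem analyticAt_mellinTail (hD : IsHolomorphicJet L D) (ha : 0 < a) (haL : a < L)
    (N : ℕ) {s : ℂ} (hs : 2 - N < s.re) : AnalyticAt ℂ (mellinTail D a N) s :=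
  (differentiableOn_mellinTail hD ha haL N).analyticAt
    ((isOpen_lt continuous_const Complex.continuous_re).mem_nhds hs)

theorem IsHolomorphicJet.analyticAt_boundary (hD : IsHolomorphicJet L D) (ha : 0 < a)
    (haL : a < L) (k : ℕ) (z : ℂ) :
    AnalyticAt ℂ (fun s : ℂ => (-1) ^ k * (a : ℂ) ^ (s - 1 + k) * D k s a) z := by
  have h1 : Differentiable ℂ (fun s : ℂ => (-1) ^ k * (a : ℂ) ^ (s - 1 + k) * D k s a) := by
    refine Differentiable.mul ?_ (hD.differentiable k a ⟨by linarith, haL⟩)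
    refine (differentiable_const _).mul ?_
    exact Differentiable.const_cpow (by fun_prop) (Or.inl (by exact_mod_cast ha.ne'))
  exact h1.analyticAt z

theorem meromorphicAt_mellinCont (hD : IsHolomorphicJet L D) (ha : 0 < a) (haL : a < L)
    (N : ℕ) {s : ℂ} (hs : 2 - N < s.re) : MeromorphicAt (mellinCont D a N) s := by
  have hp : ∀ k, MeromorphicAt (poleProd k) s := fun k =>
    ((differentiable_poleProd k).analyticAt s).meromorphicAt
  refine MeromorphicAt.add (f := fun s : ℂ => ∑ k ∈ Finset.range N,
    (-1) ^ k * (a : ℂ) ^ (s - 1 + k) * D k s a / poleProd (k + 1) s)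
    (g := fun s => (-1) ^ N / poleProd N s * mellinTail D a N s) ?_ ?_
  · refine MeromorphicAt.fun_sum fun k _ => ?_
    exact (hD.analyticAt_boundary ha haL k s).meromorphicAt.div (hp (k + 1))
  · exact ((MeromorphicAt.const _ s).div (hp N)).mul
      (analyticAt_mellinTail hD ha haL N hs).meromorphicAt

theorem poleProd_ne_zero {k j : ℕ} (hj : j ≤ k) : poleProd j (1 - k) ≠ 0 := by
  refine Finset.prod_ne_zero_iff.2 fun i hi => ?_
  have hi' : i < k := (Finset.mem_range.1 hi).trans_le hj
  have : (1 - (k : ℂ) - 1 + i) = (i : ℂ) - k := by ring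
  rw [this, sub_ne_zero]
  exact_mod_cast hi'.ne

/-- With `k + 2` integrations by parts the point `1 - k` lies inside the half plane of the tail.
Only the factor of index `k` vanishes there. It occurs in the last two boundary terms and in the
tail; undoing two integrations by parts at that point collapses their sum to the value of the jet at
`h = 0`. -/
theorem hasSimplePart_mellinCont (hD : IsHolomorphicJet L D) (ha : 0 < a) (haL : a < L) (k : ℕ) :
    HasSimplePart (mellinCont D a (k + 2)) (1 - k) (D k (1 - k) 0 / k.factorial) := by
  have hres : (1 - (k : ℂ)).re = 1 - k := by simp
  have hB := fun j => hD.analyticAt_boundary ha haL j (1 - k)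
  have hp := fun j => (differentiable_poleProd j).analyticAt (1 - (k : ℂ))
  have hsk : AnalyticAt ℂ (fun s : ℂ => s + k) (1 - k) := by fun_prop
  have hT := analyticAt_mellinTail hD ha haL (k + 2) (s := 1 - k) (by rw [hres]; push_cast; linarith)
  have hG : AnalyticAt ℂ (fun s : ℂ => ∑ j ∈ Finset.range k,
      (-1) ^ j * (a : ℂ) ^ (s - 1 + j) * D j s a / poleProd (j + 1) s) (1 - k) := by
    refine Finset.analyticAt_fun_sum _ fun j hj => ?_
    exact (hB j).div (hp (j + 1)) (poleProd_ne_zero (Finset.mem_range.1 hj))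
  have hH : AnalyticAt ℂ (fun s : ℂ => ((-1) ^ k * (a : ℂ) ^ (s - 1 + k) * D k s a
      + (-1) ^ (k + 1) * (a : ℂ) ^ (s - 1 + (k + 1 : ℕ)) * D (k + 1) s a / (s + k)
      + (-1) ^ k * mellinTail D a (k + 2) s / (s + k)) / poleProd k s) (1 - k) := by
    refine AnalyticAt.div (((hB k).add ((hB (k + 1)).div hsk (by simp))).add
      ((analyticAt_const.mul hT).div hsk (by simp))) (hp k) (poleProd_ne_zero le_rfl)
  have := HasSimplePart.of_analytic_div (F := mellinCont D a (k + 2)) hG hH ?_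
  · convert this using 1
    have hcast : (1 - (k : ℂ) + k) = 1 := by ring
    have e1 : (1 - (k : ℂ) - 1 + k) = 0 := by ring
    have e2 : (1 - (k : ℂ) - 1 + (k + 1 : ℕ)) = 1 := by push_cast; ring
    -- At this point the exponent of `h` is 0, so the tail of index `k + 1` is the integral of a
    -- derivative.
    have hI := mellinTail_eq hD ha haL (k + 1) (s := 1 - k)
      (by
        have e4 : (1 - (k : ℂ) - 2 + (k + 1 : ℕ)) = 0 := by push_cast; ring
        simpa only [e4, Complex.cpow_zero] using continuous_const)
      (by rw [e2]; norm_num)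
    rw [e2] at hI
    have hFTC : mellinTail D a (k + 1) (1 - k) = D k (1 - k) a - D k (1 - k) 0 := by
      rw [mellinTail]
      have e4 : (1 - (k : ℂ) - 2 + (k + 1 : ℕ)) = 0 := by push_cast; ring
      simp only [e4, Complex.cpow_zero, one_mul]
      refine intervalIntegral.integral_eq_sub_of_hasDerivAt (fun x hx => ?_)
        (hD.continuousOn_slice ha haL (k + 1) _).intervalIntegrable
      rw [uIcc_of_le ha.le] at hx
      exact hD.hasDerivAt k _ x ⟨by linarith [hx.1], by linarith [hx.2]⟩
    rw [hcast, e1, e2, poleProd_one_sub]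
    rw [hFTC, one_mul, Complex.cpow_one] at hI
    have hI' : mellinTail D a (k + 2) (1 - k) = (a : ℂ) * D (k + 1) (1 - k) a
        - (D k (1 - k) a - D k (1 - k) 0) := by
      linear_combination hI
    rw [hI', Complex.cpow_zero, Complex.cpow_one]
    have hk : (k.factorial : ℂ) ≠ 0 := by exact_mod_cast k.factorial_ne_zero
    have hk1 : ((-1 : ℂ)) ^ k ≠ 0 := pow_ne_zero _ (by norm_num)
    rw [pow_succ]
    field_simp
    ring
  · refine Eventually.of_forall fun s => ?_
    rw [mellinCont, Finset.sum_range_succ, Finset.sum_range_succ, add_assoc, add_assoc]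
    congr 1
    rw [poleProd_succ (k + 1), poleProd_succ k]
    have e1 : s - 1 + (k + 1 : ℕ) = s + k := by push_cast; ring
    have e2 : s - (1 - k : ℂ) = s - 1 + k := by ring
    rw [e1, e2, pow_add _ k 2, neg_one_sq, mul_one]
    simp only [div_eq_mul_inv, mul_inv]
    ring

/-- Meromorphic continuation of `s ↦ ∫₀ᵃ h^(s-2) D 0 s h dh`, with its residues. -/
theorem exists_meromorphic_mellin (hD : IsHolomorphicJet L D) (ha : 0 < a) (haL : a < L) :
    ∃ F : ℂ → ℂ, Meromorphic F ∧
      (∀ s : ℂ, 2 < s.re → F s = ∫ h in (0 : ℝ)..a, (h : ℂ) ^ (s - 2) * D 0 s h) ∧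
      ∀ k : ℕ, HasSimplePart F (1 - k) (D k (1 - k) 0 / k.factorial) := by
  have hex : ∀ s : ℂ, 2 - (⌈3 - s.re⌉₊ : ℝ) < s.re := fun s => by
    linarith [Nat.le_ceil (3 - s.re)]
  have heq : ∀ N : ℕ, ∀ s : ℂ, 2 - N < s.re →
      mellinCont D a ⌈3 - s.re⌉₊ s = mellinCont D a N s := by
    intro N s hs
    rcases le_total N ⌈3 - s.re⌉₊ with h | h
    · exact mellinCont_eq_of_le hD ha haL h hs
    · exact (mellinCont_eq_of_le hD ha haL h (hex s)).symm
  have hev : ∀ N : ℕ, ∀ s : ℂ, 2 - N < s.re →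
      ∀ᶠ w in 𝓝 s, mellinCont D a ⌈3 - w.re⌉₊ w = mellinCont D a N w := by
    intro N s hs
    filter_upwards [(isOpen_lt continuous_const Complex.continuous_re).mem_nhds hs] with w hw
    exact heq N w hw
  -- The number of integrations by parts is chosen point by point. By `heq` any other admissible
  -- number gives the same value, so near each point the function coincides with a single
  -- `mellinCont`.
  refine ⟨fun s => mellinCont D a ⌈3 - s.re⌉₊ s, fun s => ?_, fun s hs => ?_, fun k => ?_⟩
  · exact (meromorphicAt_mellinCont hD ha haL _ (hex s)).congr
      ((hev _ s (hex s)).filter_mono nhdsWithin_le_nhds |>.mono fun w hw => hw.symm)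
  · have := heq 0 s (by simpa using hs)
    refine this.trans ?_
    simp [mellinCont, mellinTail, poleProd]
  · obtain ⟨g, hg, hFg⟩ := hasSimplePart_mellinCont hD ha haL k
    refine ⟨g, hg, ?_⟩
    have h1 := (hev (k + 2) (1 - k) (by simp)).filter_mono
      (nhdsWithin_le_nhds (s := {(1 - k : ℂ)}ᶜ))
    filter_upwards [h1, hFg] with w hw hw'
    rw [hw, hw']

end Mellin

/-! ### Functions smooth in all variables and entire in `s`. -/

section HolomorphicFamilies

/-- The domain `ℂ × ℝ × (-L, L)` of the variables `(s, t, h)`. -/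
def stripDomain (L : ℝ) : Set (ℂ × ℝ × ℝ) := {p | p.2.2 ∈ Ioo (-L) L}

theorem isOpen_stripDomain (L : ℝ) : IsOpen (stripDomain L) :=
  isOpen_Ioo.preimage (continuous_snd.comp continuous_snd)

/-- Functions of `(s, t, h)` that are smooth over `ℝ` and entire in `s`. -/
structure IsSmoothHolomorphic (L : ℝ) (f : ℂ × ℝ × ℝ → ℂ) : Prop where
  contDiffOn : ContDiffOn ℝ ∞ f (stripDomain L)
  differentiable : ∀ t, ∀ h ∈ Ioo (-L) L, Differentiable ℂ fun s => f (s, t, h)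

/-- The partial derivative in `h` of a function of `(s, t, h)`. -/
noncomputable def derivLast (f : ℂ × ℝ × ℝ → ℂ) (p : ℂ × ℝ × ℝ) : ℂ := fderiv ℝ f p (0, 0, 1)

variable {L : ℝ} {f : ℂ × ℝ × ℝ → ℂ}

theorem hasFDerivAt_slice_fst {p : ℂ × ℝ × ℝ} (hf : DifferentiableAt ℝ f p) :
    HasFDerivAt (fun s => f (s, p.2))
      ((fderiv ℝ f p).comp (ContinuousLinearMap.inl ℝ ℂ (ℝ × ℝ))) p.1 :=
  HasFDerivAt.comp (f := fun s : ℂ => (s, p.2)) p.1 hf.hasFDerivAt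
    (hasFDerivAt_prodMk_left p.1 p.2)

/-- The Cauchy–Riemann equation as an identity for the real differential, a form that can itself be
differentiated in `h`. -/
theorem differentiableAt_slice_iff {p : ℂ × ℝ × ℝ} (hf : DifferentiableAt ℝ f p) :
    DifferentiableAt ℂ (fun s => f (s, p.2)) p.1 ↔
      fderiv ℝ f p (Complex.I, 0) = Complex.I • fderiv ℝ f p (1, 0) := by
  have h := hasFDerivAt_slice_fst hf
  rw [differentiableAt_complex_iff_differentiableAt_real, h.fderiv]
  simp [h.differentiableAt]

theorem IsSmoothHolomorphic.contDiffAt (hf : IsSmoothHolomorphic L f) {p : ℂ × ℝ × ℝ}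
    (hp : p ∈ stripDomain L) : ContDiffAt ℝ ∞ f p :=
  hf.contDiffOn.contDiffAt ((isOpen_stripDomain L).mem_nhds hp)

/-- The Cauchy–Riemann identity holds on an open set. Differentiating it in `h` and exchanging the
order by symmetry of the second derivative gives the same identity for `∂f/∂h`. -/
theorem IsSmoothHolomorphic.partial_last (hf : IsSmoothHolomorphic L f) :
    IsSmoothHolomorphic L (derivLast f) := by
  have hV := isOpen_stripDomain L
  have hfd : ContDiffOn ℝ ∞ (fderiv ℝ f) (stripDomain L) :=
    hf.contDiffOn.fderiv_of_isOpen hV (by simp)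
  have hsm : ContDiffOn ℝ ∞ (derivLast f) (stripDomain L) :=
    hfd.clm_apply contDiffOn_const
  refine ⟨hsm, fun t h hh s => ?_⟩
  have hp : (s, t, h) ∈ stripDomain L := hh
  have hdd : DifferentiableAt ℝ (fderiv ℝ f) (s, t, h) :=
    (hfd.contDiffAt (hV.mem_nhds hp)).differentiableAt (by simp)
  have hd : DifferentiableAt ℝ (derivLast f) (s, t, h) :=
    (hsm.contDiffAt (hV.mem_nhds hp)).differentiableAt (by simp)
  refine (differentiableAt_slice_iff hd).2 ?_
  have happ : ∀ v w, fderiv ℝ (fun q => fderiv ℝ f q v) (s, t, h) w =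
      fderiv ℝ (fderiv ℝ f) (s, t, h) w v := fun v w => by
    rw [fderiv_clm_apply hdd (differentiableAt_const v)]
    simp
  have hsymm : IsSymmSndFDerivAt ℝ f (s, t, h) :=
    (hf.contDiffAt hp).isSymmSndFDerivAt (by
      rw [minSmoothness_of_isRCLikeNormedField]
      exact WithTop.coe_le_coe.2 (le_top : (2 : ℕ∞) ≤ ⊤))
  have hCR : (fun q => fderiv ℝ f q (Complex.I, 0)) =ᶠ[𝓝 (s, t, h)]
      fun q => Complex.I • fderiv ℝ f q (1, 0) := by
    filter_upwards [hV.mem_nhds hp] with q hq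
    exact (differentiableAt_slice_iff ((hf.contDiffAt hq).differentiableAt (by simp))).1
      (hf.differentiable q.2.1 q.2.2 hq q.1)
  have hCR' := DFunLike.congr_fun (hCR.fderiv_eq (𝕜 := ℝ)) (0, 0, 1)
  have hsmul : fderiv ℝ (fun q => Complex.I • fderiv ℝ f q (1, 0)) (s, t, h) (0, 0, 1) =
      Complex.I • fderiv ℝ (fun q => fderiv ℝ f q (1, 0)) (s, t, h) (0, 0, 1) := by
    rw [fderiv_fun_const_smul (hdd.clm_apply (differentiableAt_const _))]
    rfl
  simp only [hsmul, happ] at hCR'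
  have e : derivLast f = fun q => fderiv ℝ f q (0, 0, 1) := rfl
  rw [e, happ, happ, hsymm, hsymm (1, 0)]
  exact hCR'

theorem IsSmoothHolomorphic.iterate_derivLast (hf : IsSmoothHolomorphic L f) (k : ℕ) :
    IsSmoothHolomorphic L (derivLast^[k] f) := by
  induction k with
  | zero => exact hf
  | succ k ih =>
    rw [Function.iterate_succ_apply']
    exact ih.partial_last

theorem IsSmoothHolomorphic.hasDerivAt (hf : IsSmoothHolomorphic L f) (s : ℂ) (t : ℝ) {h : ℝ}
    (hh : h ∈ Ioo (-L) L) :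
    HasDerivAt (fun h => f (s, t, h)) (derivLast f (s, t, h)) h := by
  have hp : (s, t, h) ∈ stripDomain L := hh
  have h1 := ((hf.contDiffAt hp).differentiableAt (by simp)).hasFDerivAt
  have h2 : HasDerivAt (fun h : ℝ => (s, t, h)) ((0 : ℂ), (0 : ℝ), (1 : ℝ)) h :=
    (hasDerivAt_const h s).prodMk ((hasDerivAt_const h t).prodMk (hasDerivAt_id h))
  exact h1.comp_hasDerivAt h h2

/-- The jet in `h` of `∫₀ᵇ f (s, t, h) dt`. -/
noncomputable def integratedJet (f : ℂ × ℝ × ℝ → ℂ) (b : ℝ) (k : ℕ) (s : ℂ) (h : ℝ) : ℂ :=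
  ∫ t in (0 : ℝ)..b, (derivLast^[k] f) (s, t, h)

theorem IsSmoothHolomorphic.isHolomorphicJet (hf : IsSmoothHolomorphic L f) (b : ℝ) :
    IsHolomorphicJet L (integratedJet f b) where
  continuousOn k := by
    refine continuousOn_intervalIntegral_of_continuousOn (X := ℂ × ℝ)
      (f := fun p t => (derivLast^[k] f) (p.1, t, p.2)) ?_
    refine (hf.iterate_derivLast k).contDiffOn.continuousOn.comp
      (f := fun q : (ℂ × ℝ) × ℝ => (q.1.1, q.2, q.1.2)) (by fun_prop) fun q hq => hq.1.2
  differentiable k h hh := by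
    rw [← differentiableOn_univ]
    refine differentiableOn_intervalIntegral_of_continuousOn isOpen_univ
      (f := fun s t => (derivLast^[k] f) (s, t, h)) ?_ fun t _ =>
        ((hf.iterate_derivLast k).differentiable t h hh).differentiableOn
    exact (hf.iterate_derivLast k).contDiffOn.continuousOn.comp
      (f := fun q : ℂ × ℝ => (q.1, q.2, h)) (by fun_prop) fun q _ => hh
  hasDerivAt k s h hh := by
    have hk := hf.iterate_derivLast k
    have hk1 := hf.iterate_derivLast (k + 1)
    refine hasDerivAt_intervalIntegral_of_continuousOn (U := Ioo (-L) L) isOpen_Ioo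
      (f := fun h t => (derivLast^[k] f) (s, t, h))
      (f' := fun h t => (derivLast^[k + 1] f) (s, t, h)) ?_ ?_ ?_ hh
    · intro x hx
      exact hk.contDiffOn.continuousOn.comp
        (f := fun t : ℝ => (s, t, x)) (by fun_prop) fun q _ => hx
    · exact hk1.contDiffOn.continuousOn.comp
        (f := fun q : ℝ × ℝ => (s, q.2, q.1)) (by fun_prop) fun q hq => hq.1
    · intro x hx t _
      rw [Function.iterate_succ_apply']
      exact hk.hasDerivAt s t hx

theorem IsSmoothHolomorphic.iterate_derivLast_eq (hf : IsSmoothHolomorphic L f) (k : ℕ) (s : ℂ)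
    (t : ℝ) {h : ℝ} (hh : h ∈ Ioo (-L) L) :
    (derivLast^[k] f) (s, t, h) = iteratedDeriv k (fun h => f (s, t, h)) h := by
  induction k generalizing h with
  | zero => simp
  | succ k ih =>
    rw [iteratedDeriv_succ, Function.iterate_succ_apply']
    have h1 : iteratedDeriv k (fun h => f (s, t, h)) =ᶠ[𝓝 h]
        fun h => (derivLast^[k] f) (s, t, h) := by
      filter_upwards [isOpen_Ioo.mem_nhds hh] with x hx
      exact (ih hx).symm
    rw [h1.deriv_eq]
    exact ((hf.iterate_derivLast k).hasDerivAt s t hh).deriv.symm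

end HolomorphicFamilies

/-! ### Recursions for the coefficients, solved to the order needed. -/

section CoefficientAlgebra

set_option linter.unusedSimpArgs false

/-- The Cauchy product of two sequences of coefficients. -/
def cauchyMul (f g : ℕ → ℂ) (n : ℕ) : ℂ := ∑ i ∈ Finset.range (n + 1), f i * g (n - i)

/-- The hypotheses are the Frenet system `A' = -κ B`, `B' = κ A` in terms of power series, with `k
i` the `i`-th derivative of the curvature. Here `B` is the full normal component of the tangent,
before a factor `h` is removed. -/
theorem frame_coeff {k A B : ℕ → ℂ} (hA0 : A 0 = 1) (hB0 : B 0 = 0)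
    (hA : ∀ n : ℕ, (n + 1) * A (n + 1) = -cauchyMul (fun i => k i / i.factorial) B n)
    (hB : ∀ n : ℕ, (n + 1) * B (n + 1) = cauchyMul (fun i => k i / i.factorial) A n) :
    A 1 = 0 ∧
    A 2 = (-1 / 2) * k 0 ^ 2 ∧
    A 3 = (-1 / 2) * k 0 * k 1 ∧
    A 4 = 1 / 24 * k 0 ^ 4 + (-1 / 6) * k 0 * k 2 + (-1 / 8) * k 1 ^ 2 ∧
    A 5 = 1 / 12 * k 0 ^ 3 * k 1 + (-1 / 24) * k 0 * k 3 + (-1 / 12) * k 1 * k 2 ∧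
    A 6 = (-1 / 720) * k 0 ^ 6 + 1 / 36 * k 0 ^ 3 * k 2 + 1 / 16 * k 0 ^ 2 * k 1 ^ 2
        + (-1 / 120) * k 0 * k 4 + (-1 / 48) * k 1 * k 3 + (-1 / 72) * k 2 ^ 2 ∧
    B 1 = k 0 ∧
    B 2 = 1 / 2 * k 1 ∧
    B 3 = (-1 / 6) * k 0 ^ 3 + 1 / 6 * k 2 ∧
    B 4 = (-1 / 4) * k 0 ^ 2 * k 1 + 1 / 24 * k 3 ∧
    B 5 = 1 / 120 * k 0 ^ 5 + (-1 / 12) * k 0 ^ 2 * k 2 + (-1 / 8) * k 0 * k 1 ^ 2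
        + 1 / 120 * k 4 := by
  have a1 : A 1 = 0 := by
    -- Normalization is postponed: the finite Cauchy sum is first unfolded and the coefficients
    -- already known substituted, after which `ring` closes the goal. The later coefficients follow
    -- the same pattern.
    linear_combination (norm := skip) hA 0
    simp only [cauchyMul, Finset.sum_range_succ, Finset.sum_range_zero, Nat.factorial,
      Nat.reduceSub, Nat.reduceAdd, zero_add, hA0, hB0]
    push_cast
    ring
  have b1 : B 1 = k 0 := by
    linear_combination (norm := skip) hB 0
    simp only [cauchyMul, Finset.sum_range_succ, Finset.sum_range_zero, Nat.factorial,
      Nat.reduceSub, Nat.reduceAdd, zero_add, hA0, hB0]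
    push_cast
    ring
  have a2 : A 2 = (-1 / 2) * k 0 ^ 2 := by
    linear_combination (norm := skip) 1 / 2 * hA 1
    simp only [cauchyMul, Finset.sum_range_succ, Finset.sum_range_zero, Nat.factorial,
      Nat.reduceSub, Nat.reduceAdd, zero_add, hA0, hB0, a1, b1]
    push_cast
    ring
  have b2 : B 2 = 1 / 2 * k 1 := by
    linear_combination (norm := skip) 1 / 2 * hB 1
    simp only [cauchyMul, Finset.sum_range_succ, Finset.sum_range_zero, Nat.factorial,
      Nat.reduceSub, Nat.reduceAdd, zero_add, hA0, hB0, a1, b1]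
    push_cast
    ring
  have a3 : A 3 = (-1 / 2) * k 0 * k 1 := by
    linear_combination (norm := skip) 1 / 3 * hA 2
    simp only [cauchyMul, Finset.sum_range_succ, Finset.sum_range_zero, Nat.factorial,
      Nat.reduceSub, Nat.reduceAdd, zero_add, hA0, hB0, a1, b1, a2, b2]
    push_cast
    ring
  have b3 : B 3 = (-1 / 6) * k 0 ^ 3 + 1 / 6 * k 2 := by
    linear_combination (norm := skip) 1 / 3 * hB 2
    simp only [cauchyMul, Finset.sum_range_succ, Finset.sum_range_zero, Nat.factorial,
      Nat.reduceSub, Nat.reduceAdd, zero_add, hA0, hB0, a1, b1, a2, b2]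
    push_cast
    ring
  have a4 : A 4 = 1 / 24 * k 0 ^ 4 + (-1 / 6) * k 0 * k 2 + (-1 / 8) * k 1 ^ 2 := by
    linear_combination (norm := skip) 1 / 4 * hA 3
    simp only [cauchyMul, Finset.sum_range_succ, Finset.sum_range_zero, Nat.factorial,
      Nat.reduceSub, Nat.reduceAdd, zero_add, hA0, hB0, a1, b1, a2, b2, a3, b3]
    push_cast
    ring
  have b4 : B 4 = (-1 / 4) * k 0 ^ 2 * k 1 + 1 / 24 * k 3 := by
    linear_combination (norm := skip) 1 / 4 * hB 3
    simp only [cauchyMul, Finset.sum_range_succ, Finset.sum_range_zero, Nat.factorial,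
      Nat.reduceSub, Nat.reduceAdd, zero_add, hA0, hB0, a1, b1, a2, b2, a3, b3]
    push_cast
    ring
  have a5 : A 5 = 1 / 12 * k 0 ^ 3 * k 1 + (-1 / 24) * k 0 * k 3 + (-1 / 12) * k 1 * k 2 := by
    linear_combination (norm := skip) 1 / 5 * hA 4
    simp only [cauchyMul, Finset.sum_range_succ, Finset.sum_range_zero, Nat.factorial,
      Nat.reduceSub, Nat.reduceAdd, zero_add, hA0, hB0, a1, b1, a2, b2, a3, b3, a4, b4]
    push_cast
    ring
  have b5 : B 5 = 1 / 120 * k 0 ^ 5 + (-1 / 12) * k 0 ^ 2 * k 2 + (-1 / 8) * k 0 * k 1 ^ 2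
      + 1 / 120 * k 4 := by
    linear_combination (norm := skip) 1 / 5 * hB 4
    simp only [cauchyMul, Finset.sum_range_succ, Finset.sum_range_zero, Nat.factorial,
      Nat.reduceSub, Nat.reduceAdd, zero_add, hA0, hB0, a1, b1, a2, b2, a3, b3, a4, b4]
    push_cast
    ring
  have a6 : A 6 = (-1 / 720) * k 0 ^ 6 + 1 / 36 * k 0 ^ 3 * k 2 + 1 / 16 * k 0 ^ 2 * k 1 ^ 2
      + (-1 / 120) * k 0 * k 4 + (-1 / 48) * k 1 * k 3 + (-1 / 72) * k 2 ^ 2 := by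
    linear_combination (norm := skip) 1 / 6 * hA 5
    simp only [cauchyMul, Finset.sum_range_succ, Finset.sum_range_zero, Nat.factorial,
      Nat.reduceSub, Nat.reduceAdd, zero_add, hA0, hB0, a1, b1, a2, b2, a3, b3, a4, b4, a5, b5]
    push_cast
    ring
  exact ⟨a1, a2, a3, a4, a5, a6, b1, b2, b3, b4, b5⟩

/-- The recursions for `X` and `Y` integrate the tangent to the chord: `(h X)' = A` and `(h² Y)' =
B`. Then `Q = X² + h² Y²`, and `E = Y (A Y - (B / h) X)` is what remains of the product of the two
chord-normal inner products divided by `h⁴`. -/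
theorem chord_coeff {k A B X Y Q E : ℕ → ℂ} (hA0 : A 0 = 1) (hB0 : B 0 = 0)
    (hA : ∀ n : ℕ, (n + 1) * A (n + 1) = -cauchyMul (fun i => k i / i.factorial) B n)
    (hB : ∀ n : ℕ, (n + 1) * B (n + 1) = cauchyMul (fun i => k i / i.factorial) A n)
    (hX : ∀ n : ℕ, (n + 1) * X n = A n) (hY : ∀ n : ℕ, (n + 2) * Y n = B (n + 1))
    (hQ0 : Q 0 = cauchyMul X X 0) (hQ1 : Q 1 = cauchyMul X X 1)
    (hQ : ∀ n, Q (n + 2) = cauchyMul X X (n + 2) + cauchyMul Y Y n)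
    (hE : ∀ n, E n = cauchyMul Y
      (fun n => cauchyMul A Y n - cauchyMul (fun i => B (i + 1)) X n) n) :
    Q 0 = 1 ∧
    Q 1 = 0 ∧
    Q 2 = (-1 / 12) * k 0 ^ 2 ∧
    Q 3 = (-1 / 12) * k 0 * k 1 ∧
    Q 4 = 1 / 360 * k 0 ^ 4 + (-1 / 40) * k 0 * k 2 + (-1 / 45) * k 1 ^ 2 ∧
    Q 5 = 1 / 180 * k 0 ^ 3 * k 1 + (-1 / 180) * k 0 * k 3 + (-1 / 72) * k 1 * k 2 ∧
    Q 6 = (-1 / 20160) * k 0 ^ 6 + 17 / 10080 * k 0 ^ 3 * k 2 + 29 / 6720 * k 0 ^ 2 * k 1 ^ 2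
        + (-1 / 1008) * k 0 * k 4 + (-1 / 315) * k 1 * k 3 + (-1 / 448) * k 2 ^ 2 ∧
    E 0 = (-1 / 4) * k 0 ^ 2 ∧
    E 1 = (-1 / 4) * k 0 * k 1 ∧
    E 2 = 1 / 24 * k 0 ^ 4 + (-1 / 12) * k 0 * k 2 + (-1 / 18) * k 1 ^ 2 ∧
    E 3 = 1 / 12 * k 0 ^ 3 * k 1 + (-1 / 48) * k 0 * k 3 + (-5 / 144) * k 1 * k 2 ∧
    E 4 = (-1 / 320) * k 0 ^ 6 + 13 / 480 * k 0 ^ 3 * k 2 + 1 / 16 * k 0 ^ 2 * k 1 ^ 2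
        + (-1 / 240) * k 0 * k 4 + (-1 / 120) * k 1 * k 3 + (-1 / 192) * k 2 ^ 2 := by
  obtain ⟨a1, a2, a3, a4, a5, a6, b1, b2, b3, b4, b5⟩ := frame_coeff hA0 hB0 hA hB
  have x0 : X 0 = 1 := by
    linear_combination (norm := skip) hX 0
    simp only [cauchyMul, Finset.sum_range_succ, Finset.sum_range_zero, Nat.factorial,
      Nat.reduceSub, Nat.reduceAdd, zero_add, hA0]
    push_cast
    ring
  have x1 : X 1 = 0 := by
    linear_combination (norm := skip) 1 / 2 * hX 1
    simp only [cauchyMul, Finset.sum_range_succ, Finset.sum_range_zero, Nat.factorial,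
      Nat.reduceSub, Nat.reduceAdd, zero_add, a1]
    push_cast
    ring
  have x2 : X 2 = (-1 / 6) * k 0 ^ 2 := by
    linear_combination (norm := skip) 1 / 3 * hX 2
    simp only [cauchyMul, Finset.sum_range_succ, Finset.sum_range_zero, Nat.factorial,
      Nat.reduceSub, Nat.reduceAdd, zero_add, a2]
    push_cast
    ring
  have x3 : X 3 = (-1 / 8) * k 0 * k 1 := by
    linear_combination (norm := skip) 1 / 4 * hX 3
    simp only [cauchyMul, Finset.sum_range_succ, Finset.sum_range_zero, Nat.factorial,
      Nat.reduceSub, Nat.reduceAdd, zero_add, a3]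
    push_cast
    ring
  have x4 : X 4 = 1 / 120 * k 0 ^ 4 + (-1 / 30) * k 0 * k 2 + (-1 / 40) * k 1 ^ 2 := by
    linear_combination (norm := skip) 1 / 5 * hX 4
    simp only [cauchyMul, Finset.sum_range_succ, Finset.sum_range_zero, Nat.factorial,
      Nat.reduceSub, Nat.reduceAdd, zero_add, a4]
    push_cast
    ring
  have x5 : X 5 = 1 / 72 * k 0 ^ 3 * k 1 + (-1 / 144) * k 0 * k 3 + (-1 / 72) * k 1 * k 2 := by
    linear_combination (norm := skip) 1 / 6 * hX 5
    simp only [cauchyMul, Finset.sum_range_succ, Finset.sum_range_zero, Nat.factorial,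
      Nat.reduceSub, Nat.reduceAdd, zero_add, a5]
    push_cast
    ring
  have x6 : X 6 = (-1 / 5040) * k 0 ^ 6 + 1 / 252 * k 0 ^ 3 * k 2 + 1 / 112 * k 0 ^ 2 * k 1 ^ 2
      + (-1 / 840) * k 0 * k 4 + (-1 / 336) * k 1 * k 3 + (-1 / 504) * k 2 ^ 2 := by
    linear_combination (norm := skip) 1 / 7 * hX 6
    simp only [cauchyMul, Finset.sum_range_succ, Finset.sum_range_zero, Nat.factorial,
      Nat.reduceSub, Nat.reduceAdd, zero_add, a6]
    push_cast
    ring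
  have y0 : Y 0 = 1 / 2 * k 0 := by
    linear_combination (norm := skip) 1 / 2 * hY 0
    simp only [cauchyMul, Finset.sum_range_succ, Finset.sum_range_zero, Nat.factorial,
      Nat.reduceSub, Nat.reduceAdd, zero_add, b1]
    push_cast
    ring
  have y1 : Y 1 = 1 / 6 * k 1 := by
    linear_combination (norm := skip) 1 / 3 * hY 1
    simp only [cauchyMul, Finset.sum_range_succ, Finset.sum_range_zero, Nat.factorial,
      Nat.reduceSub, Nat.reduceAdd, zero_add, b2]
    push_cast
    ring
  have y2 : Y 2 = (-1 / 24) * k 0 ^ 3 + 1 / 24 * k 2 := by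
    linear_combination (norm := skip) 1 / 4 * hY 2
    simp only [cauchyMul, Finset.sum_range_succ, Finset.sum_range_zero, Nat.factorial,
      Nat.reduceSub, Nat.reduceAdd, zero_add, b3]
    push_cast
    ring
  have y3 : Y 3 = (-1 / 20) * k 0 ^ 2 * k 1 + 1 / 120 * k 3 := by
    linear_combination (norm := skip) 1 / 5 * hY 3
    simp only [cauchyMul, Finset.sum_range_succ, Finset.sum_range_zero, Nat.factorial,
      Nat.reduceSub, Nat.reduceAdd, zero_add, b4]
    push_cast
    ring
  have y4 : Y 4 = 1 / 720 * k 0 ^ 5 + (-1 / 72) * k 0 ^ 2 * k 2 + (-1 / 48) * k 0 * k 1 ^ 2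
      + 1 / 720 * k 4 := by
    linear_combination (norm := skip) 1 / 6 * hY 4
    simp only [cauchyMul, Finset.sum_range_succ, Finset.sum_range_zero, Nat.factorial,
      Nat.reduceSub, Nat.reduceAdd, zero_add, b5]
    push_cast
    ring
  have q0 : Q 0 = 1 := by
    linear_combination (norm := skip) hQ0
    simp only [cauchyMul, Finset.sum_range_succ, Finset.sum_range_zero, Nat.factorial,
      Nat.reduceSub, Nat.reduceAdd, zero_add, x0, x1, x2, x3, x4, x5, x6, y0, y1, y2, y3, y4]
    ring
  have q1 : Q 1 = 0 := by
    linear_combination (norm := skip) hQ1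
    simp only [cauchyMul, Finset.sum_range_succ, Finset.sum_range_zero, Nat.factorial,
      Nat.reduceSub, Nat.reduceAdd, zero_add, x0, x1, x2, x3, x4, x5, x6, y0, y1, y2, y3, y4]
    ring
  have q2 : Q 2 = (-1 / 12) * k 0 ^ 2 := by
    linear_combination (norm := skip) hQ 0
    simp only [cauchyMul, Finset.sum_range_succ, Finset.sum_range_zero, Nat.factorial,
      Nat.reduceSub, Nat.reduceAdd, zero_add, x0, x1, x2, x3, x4, x5, x6, y0, y1, y2, y3, y4]
    ring
  have q3 : Q 3 = (-1 / 12) * k 0 * k 1 := by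
    linear_combination (norm := skip) hQ 1
    simp only [cauchyMul, Finset.sum_range_succ, Finset.sum_range_zero, Nat.factorial,
      Nat.reduceSub, Nat.reduceAdd, zero_add, x0, x1, x2, x3, x4, x5, x6, y0, y1, y2, y3, y4]
    ring
  have q4 : Q 4 = 1 / 360 * k 0 ^ 4 + (-1 / 40) * k 0 * k 2 + (-1 / 45) * k 1 ^ 2 := by
    linear_combination (norm := skip) hQ 2
    simp only [cauchyMul, Finset.sum_range_succ, Finset.sum_range_zero, Nat.factorial,
      Nat.reduceSub, Nat.reduceAdd, zero_add, x0, x1, x2, x3, x4, x5, x6, y0, y1, y2, y3, y4]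
    ring
  have q5 : Q 5 = 1 / 180 * k 0 ^ 3 * k 1 + (-1 / 180) * k 0 * k 3 + (-1 / 72) * k 1 * k 2 := by
    linear_combination (norm := skip) hQ 3
    simp only [cauchyMul, Finset.sum_range_succ, Finset.sum_range_zero, Nat.factorial,
      Nat.reduceSub, Nat.reduceAdd, zero_add, x0, x1, x2, x3, x4, x5, x6, y0, y1, y2, y3, y4]
    ring
  have q6 : Q 6 = (-1 / 20160) * k 0 ^ 6 + 17 / 10080 * k 0 ^ 3 * k 2
      + 29 / 6720 * k 0 ^ 2 * k 1 ^ 2 + (-1 / 1008) * k 0 * k 4 + (-1 / 315) * k 1 * k 3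
      + (-1 / 448) * k 2 ^ 2 := by
    linear_combination (norm := skip) hQ 4
    simp only [cauchyMul, Finset.sum_range_succ, Finset.sum_range_zero, Nat.factorial,
      Nat.reduceSub, Nat.reduceAdd, zero_add, x0, x1, x2, x3, x4, x5, x6, y0, y1, y2, y3, y4]
    ring
  have e0 : E 0 = (-1 / 4) * k 0 ^ 2 := by
    linear_combination (norm := skip) hE 0
    simp only [cauchyMul, Finset.sum_range_succ, Finset.sum_range_zero, Nat.factorial,
      Nat.reduceSub, Nat.reduceAdd, zero_add, hA0, hB0, a1, a2, a3, a4, a5, a6, b1, b2, b3, b4, b5, x0, x1, x2,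
          x3, x4, x5, x6, y0, y1, y2, y3, y4]
    ring
  have e1 : E 1 = (-1 / 4) * k 0 * k 1 := by
    linear_combination (norm := skip) hE 1
    simp only [cauchyMul, Finset.sum_range_succ, Finset.sum_range_zero, Nat.factorial,
      Nat.reduceSub, Nat.reduceAdd, zero_add, hA0, hB0, a1, a2, a3, a4, a5, a6, b1, b2, b3, b4, b5, x0, x1, x2,
          x3, x4, x5, x6, y0, y1, y2, y3, y4]
    ring
  have e2 : E 2 = 1 / 24 * k 0 ^ 4 + (-1 / 12) * k 0 * k 2 + (-1 / 18) * k 1 ^ 2 := by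
    linear_combination (norm := skip) hE 2
    simp only [cauchyMul, Finset.sum_range_succ, Finset.sum_range_zero, Nat.factorial,
      Nat.reduceSub, Nat.reduceAdd, zero_add, hA0, hB0, a1, a2, a3, a4, a5, a6, b1, b2, b3, b4, b5, x0, x1, x2,
          x3, x4, x5, x6, y0, y1, y2, y3, y4]
    ring
  have e3 : E 3 = 1 / 12 * k 0 ^ 3 * k 1 + (-1 / 48) * k 0 * k 3 + (-5 / 144) * k 1 * k 2 := by
    linear_combination (norm := skip) hE 3
    simp only [cauchyMul, Finset.sum_range_succ, Finset.sum_range_zero, Nat.factorial,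
      Nat.reduceSub, Nat.reduceAdd, zero_add, hA0, hB0, a1, a2, a3, a4, a5, a6, b1, b2, b3, b4, b5, x0, x1, x2,
          x3, x4, x5, x6, y0, y1, y2, y3, y4]
    ring
  have e4 : E 4 = (-1 / 320) * k 0 ^ 6 + 13 / 480 * k 0 ^ 3 * k 2 + 1 / 16 * k 0 ^ 2 * k 1 ^ 2
      + (-1 / 240) * k 0 * k 4 + (-1 / 120) * k 1 * k 3 + (-1 / 192) * k 2 ^ 2 := by
    linear_combination (norm := skip) hE 4
    simp only [cauchyMul, Finset.sum_range_succ, Finset.sum_range_zero, Nat.factorial,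
      Nat.reduceSub, Nat.reduceAdd, zero_add, hA0, hB0, a1, a2, a3, a4, a5, a6, b1, b2, b3, b4, b5, x0, x1, x2,
          x3, x4, x5, x6, y0, y1, y2, y3, y4]
    ring
  exact ⟨q0, q1, q2, q3, q4, q5, q6, e0, e1, e2, e3, e4⟩

/-- The hypothesis `hV` is `Q V' = p Q' V`, satisfied by `V = Q^p`. As `Q 0 = 1`, it determines each
coefficient from the earlier ones. -/
theorem power_coeff {p : ℂ} {Q V : ℕ → ℂ} (hQ0 : Q 0 = 1) (hQ1 : Q 1 = 0) (hV0 : V 0 = 1)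
    (hV : ∀ n, cauchyMul Q (fun i => (i + 1) * V (i + 1)) n =
      p * cauchyMul (fun i => (i + 1) * Q (i + 1)) V n) :
    V 1 = 0 ∧ V 2 = p * Q 2 ∧ V 3 = p * Q 3 ∧ V 4 = p * Q 4 + p * (p - 1) / 2 * Q 2 ^ 2 ∧
    V 5 = p * Q 5 + p * (p - 1) * Q 2 * Q 3 ∧
    V 6 = p * Q 6 + p * (p - 1) * (Q 2 * Q 4 + Q 3 ^ 2 / 2)
      + p * (p - 1) * (p - 2) / 6 * Q 2 ^ 3 := by
  have v1 : V 1 = 0 := by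
    linear_combination (norm := skip) hV 0
    simp only [cauchyMul, Finset.sum_range_succ, Finset.sum_range_zero, Nat.factorial,
      Nat.reduceSub, Nat.reduceAdd, zero_add, hQ0, hQ1, hV0]
    push_cast
    ring
  have v2 : V 2 = p * Q 2 := by
    linear_combination (norm := skip) 1 / 2 * hV 1
    simp only [cauchyMul, Finset.sum_range_succ, Finset.sum_range_zero, Nat.factorial,
      Nat.reduceSub, Nat.reduceAdd, zero_add, hQ0, hQ1, hV0, v1]
    push_cast
    ring
  have v3 : V 3 = p * Q 3 := by
    linear_combination (norm := skip) 1 / 3 * hV 2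
    simp only [cauchyMul, Finset.sum_range_succ, Finset.sum_range_zero, Nat.factorial,
      Nat.reduceSub, Nat.reduceAdd, zero_add, hQ0, hQ1, hV0, v1, v2]
    push_cast
    ring
  have v4 : V 4 = p * Q 4 + p * (p - 1) / 2 * Q 2 ^ 2 := by
    linear_combination (norm := skip) 1 / 4 * hV 3
    simp only [cauchyMul, Finset.sum_range_succ, Finset.sum_range_zero, Nat.factorial,
      Nat.reduceSub, Nat.reduceAdd, zero_add, hQ0, hQ1, hV0, v1, v2, v3]
    push_cast
    ring
  have v5 : V 5 = p * Q 5 + p * (p - 1) * Q 2 * Q 3 := by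
    linear_combination (norm := skip) 1 / 5 * hV 4
    simp only [cauchyMul, Finset.sum_range_succ, Finset.sum_range_zero, Nat.factorial,
      Nat.reduceSub, Nat.reduceAdd, zero_add, hQ0, hQ1, hV0, v1, v2, v3, v4]
    push_cast
    ring
  have v6 : V 6 = p * Q 6 + p * (p - 1) * (Q 2 * Q 4 + Q 3 ^ 2 / 2)
      + p * (p - 1) * (p - 2) / 6 * Q 2 ^ 3 := by
    linear_combination (norm := skip) 1 / 6 * hV 5
    simp only [cauchyMul, Finset.sum_range_succ, Finset.sum_range_zero, Nat.factorial,
      Nat.reduceSub, Nat.reduceAdd, zero_add, hQ0, hQ1, hV0, v1, v2, v3, v4, v5]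
    push_cast
    ring
  exact ⟨v1, v2, v3, v4, v5, v6⟩

/-- The coefficients of order `0`, `2`, `4`, `6` in `h` of the kernel on the diagonal, at
`s = 1`, `-1`, `-3`, `-5` respectively. -/
theorem kernel_coeff {k A B X Y Q E : ℕ → ℂ} {V W : ℂ → ℕ → ℂ} {G : ℂ → ℕ → ℂ}
    (hA0 : A 0 = 1) (hB0 : B 0 = 0)
    (hA : ∀ n : ℕ, (n + 1) * A (n + 1) = -cauchyMul (fun i => k i / i.factorial) B n)
    (hB : ∀ n : ℕ, (n + 1) * B (n + 1) = cauchyMul (fun i => k i / i.factorial) A n)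
    (hX : ∀ n : ℕ, (n + 1) * X n = A n) (hY : ∀ n : ℕ, (n + 2) * Y n = B (n + 1))
    (hQ0 : Q 0 = cauchyMul X X 0) (hQ1 : Q 1 = cauchyMul X X 1)
    (hQ : ∀ n, Q (n + 2) = cauchyMul X X (n + 2) + cauchyMul Y Y n)
    (hE : ∀ n, E n = cauchyMul Y
      (fun n => cauchyMul A Y n - cauchyMul (fun i => B (i + 1)) X n) n)
    (hV0 : ∀ s, V s 0 = 1) (hW0 : ∀ s, W s 0 = 1)
    (hV : ∀ s n, cauchyMul Q (fun i => (i + 1) * V s (i + 1)) n =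
      ((s - 2) / 2) * cauchyMul (fun i => (i + 1) * Q (i + 1)) (V s) n)
    (hW : ∀ s n, cauchyMul Q (fun i => (i + 1) * W s (i + 1)) n =
      ((s - 4) / 2) * cauchyMul (fun i => (i + 1) * Q (i + 1)) (W s) n)
    (hG0 : ∀ s, G s 0 = -(s * cauchyMul A (V s) 0))
    (hG : ∀ s n, G s (n + 2) =
      -(s * cauchyMul A (V s) (n + 2) + s * (s - 2) * cauchyMul E (W s) n)) :
    2 * G 1 0 = -2 ∧ 2 * G (-1) 2 = 3 / 4 * k 0 ^ 2 ∧
    2 * G (-3) 4 = 45 / 64 * k 0 ^ 4 + 5 / 4 * k 1 ^ 2 + 15 / 8 * k 0 * k 2 ∧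
    2 * G (-5) 6 = 175 / 512 * k 0 ^ 6 + 1295 / 288 * k 0 ^ 2 * k 1 ^ 2
      + 1085 / 576 * k 0 ^ 3 * k 2 + 175 / 576 * k 2 ^ 2
      + 35 / 72 * k 1 * k 3 + 35 / 144 * k 0 * k 4 := by
  obtain ⟨a1, a2, a3, a4, a5, a6, b1, b2, b3, b4, b5⟩ := frame_coeff hA0 hB0 hA hB
  obtain ⟨q0, q1, q2, q3, q4, q5, q6, e0, e1, e2, e3, e4⟩ :=
    chord_coeff hA0 hB0 hA hB hX hY hQ0 hQ1 hQ hE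
  have hv := fun s => power_coeff q0 q1 (hV0 s) (hV s)
  have hw := fun s => power_coeff q0 q1 (hW0 s) (hW s)
  simp only [q2, q3, q4, q5, q6] at hv hw
  refine ⟨by simp [hG0, cauchyMul, hA0, hV0], ?_, ?_, ?_⟩
  · obtain ⟨v1, v2, v3, v4, v5, v6⟩ := hv (-1)
    obtain ⟨w1, w2, w3, w4, w5, w6⟩ := hw (-1)
    rw [hG (-1) 0]
    simp only [cauchyMul, Finset.sum_range_succ, Finset.sum_range_zero, Nat.reduceSub,
        Nat.reduceAdd,
      zero_add, hA0, hV0, hW0, a1, a2, v1, v2, e0]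
    ring
  · obtain ⟨v1, v2, v3, v4, v5, v6⟩ := hv (-3)
    obtain ⟨w1, w2, w3, w4, w5, w6⟩ := hw (-3)
    rw [hG (-3) 2]
    simp only [cauchyMul, Finset.sum_range_succ, Finset.sum_range_zero, Nat.reduceSub,
        Nat.reduceAdd,
      zero_add, hA0, hV0, hW0, a1, a2, a3, a4, v1, v2, v3, v4, w1, w2, e0, e1, e2]
    ring
  · obtain ⟨v1, v2, v3, v4, v5, v6⟩ := hv (-5)
    obtain ⟨w1, w2, w3, w4, w5, w6⟩ := hw (-5)
    rw [hG (-5) 4]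
    simp only [cauchyMul, Finset.sum_range_succ, Finset.sum_range_zero, Nat.reduceSub,
        Nat.reduceAdd,
      zero_add, hA0, hV0, hW0, a1, a2, a3, a4, a5, a6, v1, v2, v3, v4, v5, v6, w1, w2, w3, w4,
          e0, e1, e2, e3, e4]
    ring

end CoefficientAlgebra

/-! ### Taylor coefficients of smooth functions at 0 and their calculus. -/

section TaylorCoefficients

/-- The Taylor coefficients at `0` of a function of a real variable. -/
noncomputable def taylorCoeff (f : ℝ → ℂ) (n : ℕ) : ℂ := iteratedDeriv n f 0 / n.factorial

variable {f g : ℝ → ℂ}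

theorem taylorCoeff_zero (f : ℝ → ℂ) : taylorCoeff f 0 = f 0 := by simp [taylorCoeff]

theorem taylorCoeff_congr (h : f =ᶠ[𝓝 0] g) : taylorCoeff f = taylorCoeff g := by
  ext n
  rw [taylorCoeff, h.iteratedDeriv_eq, taylorCoeff]

theorem ContDiffAt.of_infty {E F : Type*} [NormedAddCommGroup E] [NormedSpace ℝ E]
    [NormedAddCommGroup F] [NormedSpace ℝ F] {f : E → F} {x : E} (hf : ContDiffAt ℝ ∞ f x)
    (n : ℕ) : ContDiffAt ℝ n f x :=
  hf.of_le (by exact_mod_cast le_top)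

theorem contDiffAt_deriv {f : ℝ → ℂ} {x : ℝ} (hf : ContDiffAt ℝ ∞ f x) :
    ContDiffAt ℝ ∞ (deriv f) x :=
  (hf.fderiv_right (m := ∞) (by simp)).clm_apply contDiffAt_const

theorem taylorCoeff_mul (hf : ContDiffAt ℝ ∞ f 0) (hg : ContDiffAt ℝ ∞ g 0) (n : ℕ) :
    taylorCoeff (fun h => f h * g h) n = cauchyMul (taylorCoeff f) (taylorCoeff g) n := by
  rw [taylorCoeff, iteratedDeriv_fun_mul (hf.of_infty n) (hg.of_infty n), cauchyMul,
    Finset.sum_div]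
  refine Finset.sum_congr rfl fun i hi => ?_
  have hi' : i ≤ n := Nat.lt_succ_iff.1 (Finset.mem_range.1 hi)
  have h1 : (n.factorial : ℂ) ≠ 0 := by exact_mod_cast n.factorial_ne_zero
  have h2 : (i.factorial : ℂ) ≠ 0 := by exact_mod_cast i.factorial_ne_zero
  have h3 : ((n - i).factorial : ℂ) ≠ 0 := by exact_mod_cast (n - i).factorial_ne_zero
  have h4 : (n.choose i * i.factorial * (n - i).factorial : ℂ) = n.factorial := by
    exact_mod_cast Nat.choose_mul_factorial_mul_factorial hi'
  rw [taylorCoeff, taylorCoeff]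
  field_simp
  linear_combination iteratedDeriv i f 0 * iteratedDeriv (n - i) g 0 * h4

theorem taylorCoeff_add (hf : ContDiffAt ℝ ∞ f 0) (hg : ContDiffAt ℝ ∞ g 0) (n : ℕ) :
    taylorCoeff (fun h => f h + g h) n = taylorCoeff f n + taylorCoeff g n := by
  simp only [taylorCoeff]
  rw [iteratedDeriv_fun_add (hf.of_infty n) (hg.of_infty n), add_div]

theorem taylorCoeff_neg (f : ℝ → ℂ) (n : ℕ) :
    taylorCoeff (fun h => -f h) n = -taylorCoeff f n := by
  simp only [taylorCoeff]
  rw [iteratedDeriv_fun_neg, neg_div]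

theorem taylorCoeff_sub (hf : ContDiffAt ℝ ∞ f 0) (hg : ContDiffAt ℝ ∞ g 0) (n : ℕ) :
    taylorCoeff (fun h => f h - g h) n = taylorCoeff f n - taylorCoeff g n := by
  simp only [sub_eq_add_neg]
  rw [taylorCoeff_add hf hg.neg, taylorCoeff_neg]

theorem taylorCoeff_const_mul (c : ℂ) (f : ℝ → ℂ) (n : ℕ) :
    taylorCoeff (fun h => c * f h) n = c * taylorCoeff f n := by
  simp only [taylorCoeff]
  rw [iteratedDeriv_const_mul_field, mul_div_assoc]

theorem taylorCoeff_deriv (f : ℝ → ℂ) (n : ℕ) :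
    taylorCoeff (deriv f) n = (n + 1) * taylorCoeff f (n + 1) := by
  have h1 : (n.factorial : ℂ) ≠ 0 := by exact_mod_cast n.factorial_ne_zero
  have h2 : (n + 1 : ℂ) ≠ 0 := by exact_mod_cast n.succ_ne_zero
  rw [taylorCoeff, taylorCoeff, iteratedDeriv_succ', Nat.factorial_succ]
  push_cast
  field_simp

theorem taylorCoeff_id_mul (hf : ContDiffAt ℝ ∞ f 0) (n : ℕ) :
    taylorCoeff (fun h => (h : ℂ) * f h) (n + 1) = taylorCoeff f n := by
  have hid : ContDiffAt ℝ ∞ (fun h : ℝ => (h : ℂ)) 0 := Complex.ofRealCLM.contDiff.contDiffAt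
  have h0 : taylorCoeff (fun h : ℝ => (h : ℂ)) 0 = 0 := by simp [taylorCoeff]
  have hd : deriv (fun h : ℝ => (h : ℂ)) = fun _ => 1 := by
    ext x
    exact (Complex.ofRealCLM.hasDerivAt (x := x)).deriv
  have hsucc : ∀ i : ℕ, taylorCoeff (fun h : ℝ => (h : ℂ)) (i + 1) = if i = 0 then 1 else 0 := by
    intro i
    rw [taylorCoeff, iteratedDeriv_succ', hd, iteratedDeriv_const]
    split_ifs with hi
    · simp [hi]
    · simp
  rw [taylorCoeff_mul hid hf, cauchyMul, Finset.sum_range_succ', Finset.sum_range_succ']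
  simp [h0, hsucc]

theorem taylorCoeff_sq_mul (hf : ContDiffAt ℝ ∞ f 0) (n : ℕ) :
    taylorCoeff (fun h => (h : ℂ) ^ 2 * f h) (n + 2) = taylorCoeff f n := by
  have hid : ContDiffAt ℝ ∞ (fun h : ℝ => (h : ℂ)) 0 := Complex.ofRealCLM.contDiff.contDiffAt
  rw [← taylorCoeff_id_mul hf, ← taylorCoeff_id_mul (hid.mul hf)]
  congr 1
  ext h
  ring

theorem taylorCoeff_sq_mul_one (hf : ContDiffAt ℝ ∞ f 0) :
    taylorCoeff (fun h => (h : ℂ) ^ 2 * f h) 1 = 0 := by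
  have hid : ContDiffAt ℝ ∞ (fun h : ℝ => (h : ℂ)) 0 := Complex.ofRealCLM.contDiff.contDiffAt
  have : (fun h : ℝ => (h : ℂ) ^ 2 * f h) = fun h : ℝ => (h : ℂ) * ((h : ℂ) * f h) := by
    ext h
    ring
  rw [this, taylorCoeff_id_mul (hid.mul hf) 0, taylorCoeff_zero]
  simp

theorem iteratedDeriv_ofReal {φ : ℝ → ℝ} (hφ : ContDiff ℝ ∞ φ) (n : ℕ) :
    iteratedDeriv n (fun h => (φ h : ℂ)) = fun h => ((iteratedDeriv n φ h : ℝ) : ℂ) := by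
  induction n with
  | zero => simp
  | succ n ih =>
    rw [iteratedDeriv_succ, ih, iteratedDeriv_succ]
    ext h
    have hd : DifferentiableAt ℝ (iteratedDeriv n φ) h :=
      (hφ.differentiable_iteratedDeriv n (by exact_mod_cast WithTop.coe_lt_top _)) h
    exact hd.hasDerivAt.ofReal_comp.deriv

theorem contDiff_ofReal_comp {E : Type*} [NormedAddCommGroup E] [NormedSpace ℝ E] {φ : E → ℝ}
    (hφ : ContDiff ℝ ∞ φ) : ContDiff ℝ ∞ fun h => (φ h : ℂ) :=
  Complex.ofRealCLM.contDiff.comp hφ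

end TaylorCoefficients

/-! ### Taylor expansion of the regular factor of the kernel. -/

section KernelExpansion

/-- The regular factor `f` of the diagonal kernel `|h|^(s-2) f (s, t, h)`, in terms of the moving
frame: `a = ⟨T, T_h⟩`, `h b = ⟨N, T_h⟩`, and the chord has components `h x`, `h² y`. -/
noncomputable def kernelFactor (a b x y h : ℝ) (s : ℂ) : ℂ :=
  -(s * (a * Complex.exp ((s - 2) / 2 * Real.log (x * x + h ^ 2 * (y * y)))) +
    s * (s - 2) * (h ^ 2 * ((y * (a * y - b * x)) *
      Complex.exp ((s - 4) / 2 * Real.log (x * x + h ^ 2 * (y * y))))))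

/-- Logarithmic differentiation of `Q^p` near 0, where `Q` is positive because `Q 0 = 1`. This
provides the hypothesis of `power_coeff`. -/
theorem taylorCoeff_exp_log {Q : ℝ → ℝ} (hQ : ContDiff ℝ ∞ Q) (hQ0 : Q 0 = 1) (p : ℂ) :
    ContDiffAt ℝ ∞ (fun h => Complex.exp (p * Real.log (Q h))) 0 ∧
    ∀ n, cauchyMul (taylorCoeff fun h => (Q h : ℂ))
      (fun i => (i + 1) * taylorCoeff (fun h => Complex.exp (p * Real.log (Q h))) (i + 1)) n =
      p * cauchyMul (fun i => (i + 1) * taylorCoeff (fun h => (Q h : ℂ)) (i + 1))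
        (taylorCoeff fun h => Complex.exp (p * Real.log (Q h))) n := by
  have hpos : ∀ᶠ h in 𝓝 (0 : ℝ), 0 < Q h :=
    hQ.continuous.continuousAt.eventually (lt_mem_nhds (by rw [hQ0]; exact one_pos))
  have hV : ContDiffAt ℝ ∞ (fun h => Complex.exp (p * Real.log (Q h))) 0 := by
    have h1 : ContDiffAt ℝ ∞ (fun h => Real.log (Q h)) 0 :=
      hQ.contDiffAt.log (by rw [hQ0]; exact one_ne_zero)
    have h2 : ContDiffAt ℝ ∞ (fun h => (Real.log (Q h) : ℂ)) 0 :=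
      Complex.ofRealCLM.contDiff.contDiffAt.comp 0 h1
    exact (contDiffAt_const.mul h2).cexp
  have hQc := contDiff_ofReal_comp hQ
  refine ⟨hV, fun n => ?_⟩
  have hd1 : ContDiffAt ℝ ∞ (deriv fun h => Complex.exp (p * Real.log (Q h))) 0 :=
    contDiffAt_deriv hV
  have hd2 : ContDiffAt ℝ ∞ (deriv fun h => (Q h : ℂ)) 0 := contDiffAt_deriv hQc.contDiffAt
  simp only [← taylorCoeff_deriv]
  rw [← taylorCoeff_mul hQc.contDiffAt hd1, ← taylorCoeff_mul hd2 hV, ← taylorCoeff_const_mul]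
  refine congrFun (taylorCoeff_congr ?_) n
  filter_upwards [hpos] with h hh
  have hQd : HasDerivAt Q (deriv Q h) h := (hQ.differentiable (by simp) h).hasDerivAt
  have e1 := hQd.ofReal_comp
  have e2 := (((hQd.log hh.ne').ofReal_comp).const_mul p).cexp
  rw [e1.deriv, e2.deriv]
  have : (Q h : ℂ) ≠ 0 := by exact_mod_cast hh.ne'
  push_cast
  field_simp

/-- Translates the differential equations of the frame and the chord into the recursions of
`kernel_coeff`. The sequence called `B` there belongs to the function `h B(h)` here, whence the
index shift `hBsh`. -/
theorem kernelFactor_coeff {κ A B X Y : ℝ → ℝ} (hκ : ContDiff ℝ ∞ κ) (hA : ContDiff ℝ ∞ A)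
    (hB : ContDiff ℝ ∞ B) (hX : ContDiff ℝ ∞ X) (hY : ContDiff ℝ ∞ Y) (hA0 : A 0 = 1)
    (hA' : ∀ h, HasDerivAt A (-(κ h * (h * B h))) h)
    (hB' : ∀ h, HasDerivAt (fun h => h * B h) (κ h * A h) h)
    (hX' : ∀ h, HasDerivAt (fun h => h * X h) (A h) h)
    (hY' : ∀ h, HasDerivAt (fun h => h ^ 2 * Y h) (h * B h) h)
    {k : ℕ → ℂ} (hk : ∀ n, k n = iteratedDeriv n κ 0) :
    2 * taylorCoeff (fun h => kernelFactor (A h) (B h) (X h) (Y h) h 1) 0 = -2 ∧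
    2 * taylorCoeff (fun h => kernelFactor (A h) (B h) (X h) (Y h) h (-1)) 2 = 3 / 4 * k 0 ^ 2 ∧
    2 * taylorCoeff (fun h => kernelFactor (A h) (B h) (X h) (Y h) h (-3)) 4 =
      45 / 64 * k 0 ^ 4 + 5 / 4 * k 1 ^ 2 + 15 / 8 * k 0 * k 2 ∧
    2 * taylorCoeff (fun h => kernelFactor (A h) (B h) (X h) (Y h) h (-5)) 6 =
      175 / 512 * k 0 ^ 6 + 1295 / 288 * k 0 ^ 2 * k 1 ^ 2
        + 1085 / 576 * k 0 ^ 3 * k 2 + 175 / 576 * k 2 ^ 2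
        + 35 / 72 * k 1 * k 3 + 35 / 144 * k 0 * k 4 := by
  have cκ := (contDiff_ofReal_comp hκ).contDiffAt (x := 0)
  have cA := (contDiff_ofReal_comp hA).contDiffAt (x := 0)
  have cB := (contDiff_ofReal_comp hB).contDiffAt (x := 0)
  have cX := (contDiff_ofReal_comp hX).contDiffAt (x := 0)
  have cY := (contDiff_ofReal_comp hY).contDiffAt (x := 0)
  have cid : ContDiffAt ℝ ∞ (fun h : ℝ => (h : ℂ)) 0 := Complex.ofRealCLM.contDiff.contDiffAt
  -- The derivative of `h X` at 0 is both `X 0` and `A 0`.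
  have hX0 : X 0 = 1 := by
    have h1 : HasDerivAt (fun h => h * X h) (1 * X 0 + 0 * deriv X 0) 0 :=
      (hasDerivAt_id 0).mul (hX.differentiable (by simp) 0).hasDerivAt
    have := h1.unique (hX' 0)
    simpa [hA0] using this
  have hQ : ContDiff ℝ ∞ (fun h => X h * X h + h ^ 2 * (Y h * Y h)) := by fun_prop
  have hQ0 : X 0 * X 0 + 0 ^ 2 * (Y 0 * Y 0) = 1 := by simp [hX0]
  have cQ := (contDiff_ofReal_comp hQ).contDiffAt (x := 0)
  have hpow := taylorCoeff_exp_log hQ hQ0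
  have hV0 : ∀ p : ℂ, taylorCoeff (fun h => Complex.exp
      (p * Real.log (X h * X h + h ^ 2 * (Y h * Y h)))) 0 = 1 := fun p => by
    rw [taylorCoeff_zero, hQ0]
    simp
  have eQ : (fun h => ((X h * X h + h ^ 2 * (Y h * Y h) : ℝ) : ℂ)) =
      fun h => (X h : ℂ) * X h + (h : ℂ) ^ 2 * ((Y h : ℂ) * Y h) := by
    ext h
    push_cast
    rfl
  have cXX := cX.mul cX
  have cYY := cY.mul cY
  have cE := cY.mul ((cA.mul cY).sub (cB.mul cX))
  have hBsh : ∀ n, taylorCoeff (fun h => ((h * B h : ℝ) : ℂ)) (n + 1) =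
      taylorCoeff (fun h => (B h : ℂ)) n := fun n => by
    simp only [Complex.ofReal_mul]
    exact taylorCoeff_id_mul cB n
  have cB' : ContDiffAt ℝ ∞ (fun h => ((h * B h : ℝ) : ℂ)) 0 :=
    (contDiff_ofReal_comp (contDiff_id.mul hB)).contDiffAt
  have hK : taylorCoeff (fun h => (κ h : ℂ)) = fun i => k i / i.factorial := by
    ext i
    rw [taylorCoeff, iteratedDeriv_ofReal hκ, hk]
  refine kernel_coeff (k := k) (A := taylorCoeff fun h => (A h : ℂ))
    (B := taylorCoeff fun h => ((h * B h : ℝ) : ℂ)) (X := taylorCoeff fun h => (X h : ℂ))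
    (Y := taylorCoeff fun h => (Y h : ℂ))
    (Q := taylorCoeff fun h => ((X h * X h + h ^ 2 * (Y h * Y h) : ℝ) : ℂ))
    (E := taylorCoeff fun h => ((Y h : ℂ) * (A h * Y h - B h * X h)))
    (V := fun s => taylorCoeff fun h => Complex.exp
      ((s - 2) / 2 * Real.log (X h * X h + h ^ 2 * (Y h * Y h))))
    (W := fun s => taylorCoeff fun h => Complex.exp
      ((s - 4) / 2 * Real.log (X h * X h + h ^ 2 * (Y h * Y h))))
    (G := fun s => taylorCoeff fun h => kernelFactor (A h) (B h) (X h) (Y h) h s)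
    (by simp [taylorCoeff_zero, hA0]) (by simp [taylorCoeff_zero])
    ?_ ?_ ?_ ?_ ?_ ?_ ?_ ?_ (fun s => hV0 _) (fun s => hV0 _) (fun s => (hpow _).2)
    (fun s => (hpow _).2) ?_ ?_
  · intro n
    rw [← hK, ← taylorCoeff_deriv, ← taylorCoeff_mul cκ cB', ← taylorCoeff_neg]
    refine congrFun (taylorCoeff_congr (Eventually.of_forall fun h => ?_)) n
    simpa using (hA' h).ofReal_comp.deriv
  · intro n
    rw [← hK, ← taylorCoeff_deriv, ← taylorCoeff_mul cκ cA]
    refine congrFun (taylorCoeff_congr (Eventually.of_forall fun h => ?_)) n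
    simpa using (hB' h).ofReal_comp.deriv
  · intro n
    rw [← taylorCoeff_id_mul cX, ← taylorCoeff_deriv]
    refine congrFun (taylorCoeff_congr (Eventually.of_forall fun h => ?_)) n
    simpa using (hX' h).ofReal_comp.deriv
  · intro n
    have := taylorCoeff_deriv (fun h => (h : ℂ) ^ 2 * (Y h : ℂ)) (n + 1)
    rw [taylorCoeff_sq_mul cY] at this
    push_cast at this
    have e : (n : ℂ) + 1 + 1 = n + 2 := by ring
    rw [e] at this
    rw [← this]
    refine congrFun (taylorCoeff_congr (Eventually.of_forall fun h => ?_)) (n + 1)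
    simpa using (hY' h).ofReal_comp.deriv
  · rw [eQ, taylorCoeff_add cXX ((cid.pow 2).mul cYY), taylorCoeff_mul cX cX,
      taylorCoeff_zero fun h : ℝ => (h : ℂ) ^ 2 * ((Y h : ℂ) * Y h)]
    simp
  · rw [eQ, taylorCoeff_add cXX ((cid.pow 2).mul cYY), taylorCoeff_mul cX cX,
      taylorCoeff_sq_mul_one cYY, add_zero]
  · intro n
    rw [eQ, taylorCoeff_add cXX ((cid.pow 2).mul cYY), taylorCoeff_mul cX cX,
      taylorCoeff_sq_mul cYY, taylorCoeff_mul cY cY]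
  · intro n
    rw [taylorCoeff_mul cY ((cA.mul cY).sub (cB.mul cX))]
    congr 1
    ext m
    simp only [hBsh]
    rw [taylorCoeff_sub (cA.mul cY) (cB.mul cX), taylorCoeff_mul cA cY, taylorCoeff_mul cB cX]
  · intro s
    have hV := (hpow ((s - 2) / 2)).1
    have hW := (hpow ((s - 4) / 2)).1
    rw [← taylorCoeff_mul cA hV, taylorCoeff_zero, taylorCoeff_zero]
    simp [kernelFactor]
  · intro s n
    have hV := (hpow ((s - 2) / 2)).1
    have hW := (hpow ((s - 4) / 2)).1
    simp only [kernelFactor]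
    rw [taylorCoeff_neg, taylorCoeff_add (contDiffAt_const.mul (cA.mul hV))
      (contDiffAt_const.mul ((cid.pow 2).mul (cE.mul hW))), taylorCoeff_const_mul,
      taylorCoeff_const_mul, taylorCoeff_sq_mul (cE.mul hW), taylorCoeff_mul cE hW,
      taylorCoeff_mul cA hV]

end KernelExpansion

/-! ### The double layer kernel in the plane. -/

theorem Plane.inner_eq (p q : Plane) : inner ℝ p q = p 0 * q 0 + p 1 * q 1 := by
  simp [PiLp.inner_apply, Fin.sum_univ_two, mul_comm]

theorem Plane.norm_sq_eq (p : Plane) : ‖p‖ ^ 2 = p 0 ^ 2 + p 1 ^ 2 := by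
  rw [EuclideanSpace.real_norm_sq_eq, Fin.sum_univ_two]

/-- The kernel `∂_n ∂_m ‖v - u‖ ^ s` of the double layer, where `x = v - u`. -/
noncomputable def layerKernel (s : ℂ) (n m x : Plane) : ℂ :=
  -(s * (‖x‖ : ℂ) ^ (s - 2) * (inner ℝ n m : ℝ) +
    s * (s - 2) * (‖x‖ : ℂ) ^ (s - 4) * ((inner ℝ x n : ℝ) * (inner ℝ x m : ℝ)))

theorem layerKernel_smul (s : ℂ) (a b : ℝ) (n m x : Plane) :
    layerKernel s (a • n) (b • m) x = (a * b : ℝ) * layerKernel s n m x := by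
  simp only [layerKernel, inner_smul_left, inner_smul_right, conj_trivial]
  push_cast
  ring

theorem layerKernel_comm (s : ℂ) (n m x : Plane) :
    layerKernel s n m (-x) = layerKernel s m n x := by
  simp only [layerKernel, norm_neg, inner_neg_left, real_inner_comm n m]
  push_cast
  ring

/-! ### Frenet frame, chord, and the kernel near the diagonal. -/

namespace SmoothClosedCurve

variable (C : SmoothClosedCurve)

/-- The coordinates of the unit tangent vector. -/
noncomputable def vel (i : Fin 2) (t : ℝ) : ℝ := deriv C.γ t i

/-- The unit normal vector obtained by rotating the tangent vector. -/
noncomputable def normal (t : ℝ) : Plane := !₂[-C.vel 1 t, C.vel 0 t]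

theorem contDiff_deriv : ContDiff ℝ ∞ (deriv C.γ) := by
  have := C.smooth
  rw [contDiff_infty_iff_deriv] at this
  exact this.2

theorem contDiff_coord (i : Fin 2) : ContDiff ℝ ∞ fun t => C.γ t i :=
  contDiff_euclidean.1 C.smooth i

theorem contDiff_vel (i : Fin 2) : ContDiff ℝ ∞ (C.vel i) :=
  contDiff_euclidean.1 C.contDiff_deriv i

theorem hasDerivAt_coord (i : Fin 2) (t : ℝ) : HasDerivAt (fun t => C.γ t i) (C.vel i t) t :=
  (EuclideanSpace.proj i : Plane →L[ℝ] ℝ).hasFDerivAt.comp_hasDerivAt t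
    (C.smooth.differentiable (by simp) t).hasDerivAt

theorem deriv_vel (i : Fin 2) (t : ℝ) : deriv (C.vel i) t = deriv (deriv C.γ) t i :=
  ((EuclideanSpace.proj i : Plane →L[ℝ] ℝ).hasFDerivAt.comp_hasDerivAt t
    (C.contDiff_deriv.differentiable (by simp) t).hasDerivAt).deriv

theorem vel_sq (t : ℝ) : C.vel 0 t ^ 2 + C.vel 1 t ^ 2 = 1 := by
  have := Plane.norm_sq_eq (deriv C.γ t)
  rw [C.unit_speed] at this
  simpa [vel] using this.symm

theorem curvature_eq (t : ℝ) :
    C.curvature t = C.vel 0 t * deriv (C.vel 1) t - C.vel 1 t * deriv (C.vel 0) t := by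
  rw [deriv_vel, deriv_vel]
  rfl

theorem contDiff_curvature : ContDiff ℝ ∞ C.curvature := by
  have h : ∀ i, ContDiff ℝ ∞ (deriv (C.vel i)) := fun i => by
    have := C.contDiff_vel i
    rw [contDiff_infty_iff_deriv] at this
    exact this.2
  rw [funext C.curvature_eq]
  exact ((C.contDiff_vel 0).mul (h 1)).sub ((C.contDiff_vel 1).mul (h 0))

theorem vel_mul_deriv (t : ℝ) :
    C.vel 0 t * deriv (C.vel 0) t + C.vel 1 t * deriv (C.vel 1) t = 0 := by
  have h : ∀ i, HasDerivAt (C.vel i) (deriv (C.vel i) t) t := fun i =>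
    ((C.contDiff_vel i).differentiable (by simp) t).hasDerivAt
  have h1 := ((h 0).pow 2).add ((h 1).pow 2)
  have h2 : HasDerivAt (C.vel 0 ^ 2 + C.vel 1 ^ 2) 0 t := by
    have : C.vel 0 ^ 2 + C.vel 1 ^ 2 = fun _ => (1 : ℝ) := funext fun t => C.vel_sq t
    rw [this]
    exact hasDerivAt_const t 1
  have h3 := h1.unique h2
  norm_num at h3
  linarith

theorem hasDerivAt_vel_zero (t : ℝ) : HasDerivAt (C.vel 0) (-(C.curvature t * C.vel 1 t)) t := by
  have h := ((C.contDiff_vel 0).differentiable (by simp) t).hasDerivAt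
  refine h.congr_deriv ?_
  rw [curvature_eq]
  linear_combination (-deriv (C.vel 0) t) * C.vel_sq t + C.vel 0 t * C.vel_mul_deriv t

theorem hasDerivAt_vel_one (t : ℝ) : HasDerivAt (C.vel 1) (C.curvature t * C.vel 0 t) t := by
  have h := ((C.contDiff_vel 1).differentiable (by simp) t).hasDerivAt
  refine h.congr_deriv ?_
  rw [curvature_eq]
  linear_combination (-deriv (C.vel 1) t) * C.vel_sq t + C.vel 1 t * C.vel_mul_deriv t

/-- Reducing both parameters to one period, injectivity would make `h` a nonzero integer multiple of
the period. -/
theorem γ_add_ne {t h : ℝ} (h0 : h ≠ 0) (hL : |h| < C.L) : C.γ (t + h) ≠ C.γ t := by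
  intro heq
  have hp : ∀ t, C.γ (toIcoMod C.L_pos 0 t) = C.γ t := fun t => by
    rw [toIcoMod]
    exact C.periodic.sub_zsmul_eq _
  have hmem : ∀ t, toIcoMod C.L_pos 0 t ∈ Ico 0 C.L := fun t => by
    simpa using toIcoMod_mem_Ico C.L_pos 0 t
  have h1 := C.injOn (hmem (t + h)) (hmem t) (by rw [hp, hp, heq])
  rw [toIcoMod, toIcoMod] at h1
  set m := toIcoDiv C.L_pos 0 (t + h)
  set n := toIcoDiv C.L_pos 0 t
  simp only [zsmul_eq_mul] at h1
  have h2 : h = ((m - n : ℤ) : ℝ) * C.L := by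
    push_cast
    linarith
  have h3 : (m - n : ℤ) ≠ 0 := by
    intro h4
    rw [h4] at h2
    simp at h2
    exact h0 h2
  have h4 : (1 : ℝ) ≤ |((m - n : ℤ) : ℝ)| := by
    rw [← Int.cast_abs]
    exact_mod_cast Int.one_le_abs h3
  rw [h2, abs_mul, abs_of_pos C.L_pos] at hL
  nlinarith [C.L_pos]

/-- `⟨T t, T (t + h)⟩` -/
noncomputable def tanTan (p : ℝ × ℝ) : ℝ :=
  C.vel 0 p.1 * C.vel 0 (p.1 + p.2) + C.vel 1 p.1 * C.vel 1 (p.1 + p.2)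

/-- `⟨N t, T (t + h)⟩` -/
noncomputable def norTan (p : ℝ × ℝ) : ℝ :=
  C.vel 0 p.1 * C.vel 1 (p.1 + p.2) - C.vel 1 p.1 * C.vel 0 (p.1 + p.2)

/-- `⟨T t, γ (t + h) - γ t⟩` -/
noncomputable def tanChord (p : ℝ × ℝ) : ℝ :=
  C.vel 0 p.1 * (C.γ (p.1 + p.2) 0 - C.γ p.1 0) + C.vel 1 p.1 * (C.γ (p.1 + p.2) 1 - C.γ p.1 1)

/-- `⟨N t, γ (t + h) - γ t⟩` -/
noncomputable def norChord (p : ℝ × ℝ) : ℝ :=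
  C.vel 0 p.1 * (C.γ (p.1 + p.2) 1 - C.γ p.1 1) - C.vel 1 p.1 * (C.γ (p.1 + p.2) 0 - C.γ p.1 0)

theorem contDiff_vel_fst (i : Fin 2) : ContDiff ℝ ∞ fun p : ℝ × ℝ => C.vel i p.1 :=
  (C.contDiff_vel i).comp contDiff_fst

theorem contDiff_vel_add (i : Fin 2) : ContDiff ℝ ∞ fun p : ℝ × ℝ => C.vel i (p.1 + p.2) :=
  (C.contDiff_vel i).comp (contDiff_fst.add contDiff_snd)

theorem contDiff_chord (i : Fin 2) :
    ContDiff ℝ ∞ fun p : ℝ × ℝ => C.γ (p.1 + p.2) i - C.γ p.1 i :=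
  ((C.contDiff_coord i).comp (contDiff_fst.add contDiff_snd)).sub
    ((C.contDiff_coord i).comp contDiff_fst)

theorem contDiff_tanTan : ContDiff ℝ ∞ C.tanTan :=
  ((C.contDiff_vel_fst 0).mul (C.contDiff_vel_add 0)).add
    ((C.contDiff_vel_fst 1).mul (C.contDiff_vel_add 1))

theorem contDiff_norTan : ContDiff ℝ ∞ C.norTan :=
  ((C.contDiff_vel_fst 0).mul (C.contDiff_vel_add 1)).sub
    ((C.contDiff_vel_fst 1).mul (C.contDiff_vel_add 0))

theorem contDiff_tanChord : ContDiff ℝ ∞ C.tanChord :=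
  ((C.contDiff_vel_fst 0).mul (C.contDiff_chord 0)).add
    ((C.contDiff_vel_fst 1).mul (C.contDiff_chord 1))

theorem contDiff_norChord : ContDiff ℝ ∞ C.norChord :=
  ((C.contDiff_vel_fst 0).mul (C.contDiff_chord 1)).sub
    ((C.contDiff_vel_fst 1).mul (C.contDiff_chord 0))

theorem hasDerivAt_tanTan (t h : ℝ) :
    HasDerivAt (fun h => C.tanTan (t, h)) (-(C.curvature (t + h) * C.norTan (t, h))) h := by
  have h0 := (C.hasDerivAt_vel_zero (t + h)).comp_const_add t h
  have h1 := (C.hasDerivAt_vel_one (t + h)).comp_const_add t h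
  refine ((h0.const_mul (C.vel 0 t)).add (h1.const_mul (C.vel 1 t))).congr_deriv ?_
  simp only [norTan]
  ring

theorem hasDerivAt_norTan (t h : ℝ) :
    HasDerivAt (fun h => C.norTan (t, h)) (C.curvature (t + h) * C.tanTan (t, h)) h := by
  have h0 := (C.hasDerivAt_vel_zero (t + h)).comp_const_add t h
  have h1 := (C.hasDerivAt_vel_one (t + h)).comp_const_add t h
  refine ((h1.const_mul (C.vel 0 t)).sub (h0.const_mul (C.vel 1 t))).congr_deriv ?_
  simp only [tanTan]
  ring

theorem hasDerivAt_tanChord (t h : ℝ) :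
    HasDerivAt (fun h => C.tanChord (t, h)) (C.tanTan (t, h)) h := by
  have h0 := ((C.hasDerivAt_coord 0 (t + h)).comp_const_add t h).sub_const (C.γ t 0)
  have h1 := ((C.hasDerivAt_coord 1 (t + h)).comp_const_add t h).sub_const (C.γ t 1)
  exact (h0.const_mul (C.vel 0 t)).add (h1.const_mul (C.vel 1 t))

theorem hasDerivAt_norChord (t h : ℝ) :
    HasDerivAt (fun h => C.norChord (t, h)) (C.norTan (t, h)) h := by
  have h0 := ((C.hasDerivAt_coord 0 (t + h)).comp_const_add t h).sub_const (C.γ t 0)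
  have h1 := ((C.hasDerivAt_coord 1 (t + h)).comp_const_add t h).sub_const (C.γ t 1)
  exact (h1.const_mul (C.vel 0 t)).sub (h0.const_mul (C.vel 1 t))

theorem tanTan_zero (t : ℝ) : C.tanTan (t, 0) = 1 := by
  simp only [tanTan, add_zero, ← C.vel_sq t]
  ring

theorem norTan_zero (t : ℝ) : C.norTan (t, 0) = 0 := by
  simp only [norTan, add_zero]
  ring

/-- Hadamard's lemma is applied once to the tangential chord and the normal tangent component, and
twice to the normal chord, which vanishes to second order because the chord is tangent to the curve
at `h = 0`. -/
theorem exists_chord_factors : ∃ X B Y : ℝ × ℝ → ℝ,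
    ContDiff ℝ ∞ X ∧ ContDiff ℝ ∞ B ∧ ContDiff ℝ ∞ Y ∧
    (∀ t h, C.tanChord (t, h) = h * X (t, h)) ∧ (∀ t h, C.norTan (t, h) = h * B (t, h)) ∧
    ∀ t h, C.norChord (t, h) = h ^ 2 * Y (t, h) := by
  obtain ⟨X, hX, hX'⟩ := exists_contDiff_eq_mul C.contDiff_tanChord
    (fun t => by simp [tanChord])
  obtain ⟨B, hB, hB'⟩ := exists_contDiff_eq_mul C.contDiff_norTan C.norTan_zero
  obtain ⟨Z, hZ, hZ'⟩ := exists_contDiff_eq_mul C.contDiff_norChord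
    (fun t => by simp [norChord])
  have hZ0 : ∀ t, Z (t, 0) = 0 := fun t => by
    have h1 := C.hasDerivAt_norChord t 0
    simp only [hZ', norTan_zero] at h1
    have hZd : DifferentiableAt ℝ (fun h => Z (t, h)) 0 :=
      (hZ.comp (contDiff_prodMk_right t)).differentiable (by simp) 0
    have h2 : HasDerivAt (fun h : ℝ => h * Z (t, h))
        (1 * Z (t, 0) + 0 * deriv (fun h => Z (t, h)) 0) 0 :=
      (hasDerivAt_id (0 : ℝ)).mul hZd.hasDerivAt
    have := h1.unique h2
    simpa using this.symm
  obtain ⟨Y, hY, hY'⟩ := exists_contDiff_eq_mul hZ hZ0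
  exact ⟨X, B, Y, hX, hB, hY, hX', hB', fun t h => by rw [hZ', hY']; ring⟩

theorem chord_sq (t h : ℝ) :
    ‖C.γ (t + h) - C.γ t‖ ^ 2 = C.tanChord (t, h) ^ 2 + C.norChord (t, h) ^ 2 := by
  rw [Plane.norm_sq_eq]
  simp only [tanChord, norChord, PiLp.sub_apply]
  linear_combination (-((C.γ (t + h) 0 - C.γ t 0) ^ 2 + (C.γ (t + h) 1 - C.γ t 1) ^ 2)) *
    C.vel_sq t

theorem inner_normal_normal (t h : ℝ) :
    inner ℝ (C.normal t) (C.normal (t + h)) = C.tanTan (t, h) := by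
  rw [Plane.inner_eq]
  simp [normal, tanTan]
  ring

theorem inner_chord_normal (t h : ℝ) :
    inner ℝ (C.γ (t + h) - C.γ t) (C.normal t) = C.norChord (t, h) := by
  rw [Plane.inner_eq]
  simp [normal, norChord]
  ring

theorem inner_chord_normal_add (t h : ℝ) :
    inner ℝ (C.γ (t + h) - C.γ t) (C.normal (t + h)) =
      C.tanTan (t, h) * C.norChord (t, h) - C.norTan (t, h) * C.tanChord (t, h) := by
  rw [Plane.inner_eq]
  simp only [normal, norChord, tanTan, norTan, tanChord, PiLp.sub_apply, PiLp.toLp_apply,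
    Matrix.cons_val_zero, Matrix.cons_val_one]
  linear_combination (C.vel 1 (t + h) * (C.γ (t + h) 0 - C.γ t 0)
    - C.vel 0 (t + h) * (C.γ (t + h) 1 - C.γ t 1)) * C.vel_sq t

/-- Off `h = 0` this is the squared chord length over `h²`, positive by embeddedness; at `h = 0` it
is 1 by unit speed. -/
theorem chord_factor_pos {X Y : ℝ × ℝ → ℝ} (hX : ∀ t h, C.tanChord (t, h) = h * X (t, h))
    (hXc : ContDiff ℝ ∞ X)
    (hY : ∀ t h, C.norChord (t, h) = h ^ 2 * Y (t, h)) (t : ℝ) {h : ℝ} (hh : h ∈ Ioo (-C.L) C.L) :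
    0 < X (t, h) * X (t, h) + h ^ 2 * (Y (t, h) * Y (t, h)) := by
  rcases eq_or_ne h 0 with rfl | h0
  · have h1 := C.hasDerivAt_tanChord t 0
    simp only [hX, tanTan_zero] at h1
    have hXd : DifferentiableAt ℝ (fun h => X (t, h)) 0 :=
      (hXc.comp (contDiff_prodMk_right t)).differentiable (by simp) 0
    have h2 : HasDerivAt (fun h : ℝ => h * X (t, h))
        (1 * X (t, 0) + 0 * deriv (fun h => X (t, h)) 0) 0 :=
      (hasDerivAt_id (0 : ℝ)).mul hXd.hasDerivAt
    have h3 : X (t, 0) = 1 := by simpa using (h1.unique h2).symm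
    simp [h3]
  · have h1 : 0 < ‖C.γ (t + h) - C.γ t‖ ^ 2 := by
      have := norm_pos_iff.2 (sub_ne_zero.2 (C.γ_add_ne (t := t) h0 (abs_lt.2 hh)))
      positivity
    rw [chord_sq, hX, hY] at h1
    have h2 : 0 < h ^ 2 := by positivity
    refine pos_of_mul_pos_right (a := h ^ 2) ?_ h2.le
    calc (0 : ℝ) < _ := h1
      _ = _ := by ring

/-- The chord has length `h √q` with both factors positive, so its complex powers split. In the
second term the two inner products contribute `h⁴`, which turns `h^(s-4)` into `h^(s-2)` times `h²`.
-/
theorem layerKernel_chord {X B Y : ℝ × ℝ → ℝ} (hX : ∀ t h, C.tanChord (t, h) = h * X (t, h))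
    (hB : ∀ t h, C.norTan (t, h) = h * B (t, h))
    (hY : ∀ t h, C.norChord (t, h) = h ^ 2 * Y (t, h)) (s : ℂ) (t : ℝ) {h : ℝ} (h0 : 0 < h)
    (hpos : 0 < X (t, h) * X (t, h) + h ^ 2 * (Y (t, h) * Y (t, h))) :
    layerKernel s (C.normal t) (C.normal (t + h)) (C.γ (t + h) - C.γ t) =
      (h : ℂ) ^ (s - 2) *
        kernelFactor (C.tanTan (t, h)) (B (t, h)) (X (t, h)) (Y (t, h)) h s := by
  set q := X (t, h) * X (t, h) + h ^ 2 * (Y (t, h) * Y (t, h)) with hq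
  have hnorm : ‖C.γ (t + h) - C.γ t‖ = h * √q := by
    have h1 := C.chord_sq t h
    rw [hX, hY] at h1
    rw [← Real.sqrt_sq (norm_nonneg _), h1, ← Real.sqrt_sq h0.le, ← Real.sqrt_mul (sq_nonneg _),
      Real.sqrt_sq h0.le, hq]
    congr 1
    ring
  have hq0 : ((√q : ℝ) : ℂ) ≠ 0 := by exact_mod_cast (Real.sqrt_pos.2 hpos).ne'
  have hpow : ∀ w : ℂ, (‖C.γ (t + h) - C.γ t‖ : ℂ) ^ w =
      (h : ℂ) ^ w * Complex.exp (w / 2 * Real.log q) := fun w => by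
    rw [hnorm, Complex.ofReal_mul, Complex.mul_cpow_ofReal_nonneg h0.le (Real.sqrt_nonneg _),
      Complex.cpow_def_of_ne_zero hq0, ← Complex.ofReal_log (Real.sqrt_nonneg _),
      Real.log_sqrt hpos.le]
    congr 2
    push_cast
    ring
  have hc : (h : ℂ) ≠ 0 := by exact_mod_cast h0.ne'
  have hshift : (h : ℂ) ^ (s - 2) = (h : ℂ) ^ (s - 4) * (h : ℂ) ^ 2 := by
    rw [← Complex.cpow_ofNat, ← Complex.cpow_add _ _ hc]
    congr 1
    ring
  rw [layerKernel, inner_normal_normal, inner_chord_normal, inner_chord_normal_add, hpow, hpow,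
    kernelFactor, hX, hY, hB, ← hq, hshift]
  push_cast
  ring

theorem contDiffOn_cexp_log {Q : ℝ × ℝ → ℝ} {L : ℝ} (hQ : ContDiff ℝ ∞ Q)
    (hpos : ∀ t, ∀ h ∈ Ioo (-L) L, 0 < Q (t, h)) {P : ℂ → ℂ} (hP : ContDiff ℝ ∞ P) :
    ContDiffOn ℝ ∞ (fun p : ℂ × ℝ × ℝ => Complex.exp (P p.1 * Real.log (Q p.2)))
      (stripDomain L) := by
  have h1 : ContDiffOn ℝ ∞ (fun p : ℂ × ℝ × ℝ => Real.log (Q p.2)) (stripDomain L) :=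
    (hQ.comp contDiff_snd).contDiffOn.log fun p hp => (hpos p.2.1 p.2.2 hp).ne'
  have h2 : ContDiffOn ℝ ∞ (fun p : ℂ × ℝ × ℝ => (Real.log (Q p.2) : ℂ)) (stripDomain L) :=
    Complex.ofRealCLM.contDiff.comp_contDiffOn h1
  exact ((hP.comp contDiff_fst).contDiffOn.mul h2).cexp

theorem isSmoothHolomorphic_kernelFactor {L : ℝ} {A B X Y : ℝ × ℝ → ℝ} (hA : ContDiff ℝ ∞ A)
    (hB : ContDiff ℝ ∞ B) (hX : ContDiff ℝ ∞ X) (hY : ContDiff ℝ ∞ Y)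
    (hpos : ∀ t, ∀ h ∈ Ioo (-L) L,
      0 < X (t, h) * X (t, h) + h ^ 2 * (Y (t, h) * Y (t, h))) :
    IsSmoothHolomorphic L fun p =>
      kernelFactor (A p.2) (B p.2) (X p.2) (Y p.2) p.2.2 p.1 := by
  have hQ : ContDiff ℝ ∞ fun p : ℝ × ℝ => X p * X p + p.2 ^ 2 * (Y p * Y p) := by fun_prop
  have lift : ∀ {φ : ℝ × ℝ → ℝ}, ContDiff ℝ ∞ φ →
      ContDiffOn ℝ ∞ (fun p : ℂ × ℝ × ℝ => (φ p.2 : ℂ)) (stripDomain L) := fun h =>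
    ((contDiff_ofReal_comp h).comp contDiff_snd).contDiffOn
  have hs : ContDiffOn ℝ ∞ (fun p : ℂ × ℝ × ℝ => p.1) (stripDomain L) := contDiff_fst.contDiffOn
  have hh : ContDiffOn ℝ ∞ (fun p : ℂ × ℝ × ℝ => (p.2.2 : ℂ)) (stripDomain L) :=
    lift contDiff_snd
  have hP : ∀ c : ℂ, ContDiff ℝ ∞ fun s : ℂ => (s - c) / 2 := fun c =>
    (contDiff_id.sub contDiff_const).div_const 2
  constructor
  · exact ((hs.mul ((lift hA).mul (contDiffOn_cexp_log hQ hpos (hP 2)))).add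
      ((hs.mul (hs.sub contDiffOn_const)).mul ((hh.pow 2).mul
        (((lift hY).mul (((lift hA).mul (lift hY)).sub ((lift hB).mul (lift hX)))).mul
          (contDiffOn_cexp_log hQ hpos (hP 4)))))).neg
  · intro t h _
    simp only [kernelFactor]
    fun_prop

/-- The double layer kernel near the diagonal is `h^(s-2)` times a smooth factor, with explicit
Taylor coefficients at `h = 0`. -/
theorem exists_smooth_factor : ∃ f : ℂ × ℝ × ℝ → ℂ, IsSmoothHolomorphic C.L f ∧
    (∀ s t h, 0 < h → h < C.L → layerKernel s (C.normal t) (C.normal (t + h))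
      (C.γ (t + h) - C.γ t) = (h : ℂ) ^ (s - 2) * f (s, t, h)) ∧
    ∀ t, 2 * taylorCoeff (fun h => f (1, t, h)) 0 = -2 ∧
      2 * taylorCoeff (fun h => f (-1, t, h)) 2 = (3 / 4 * C.κ 0 t ^ 2 : ℝ) ∧
      2 * taylorCoeff (fun h => f (-3, t, h)) 4 = (45 / 64 * C.κ 0 t ^ 4 + 5 / 4 * C.κ 1 t ^ 2
        + 15 / 8 * C.κ 0 t * C.κ 2 t : ℝ) ∧
      2 * taylorCoeff (fun h => f (-5, t, h)) 6 =
        (175 / 512 * C.κ 0 t ^ 6 + 1295 / 288 * C.κ 0 t ^ 2 * C.κ 1 t ^ 2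
          + 1085 / 576 * C.κ 0 t ^ 3 * C.κ 2 t + 175 / 576 * C.κ 2 t ^ 2
          + 35 / 72 * C.κ 1 t * C.κ 3 t + 35 / 144 * C.κ 0 t * C.κ 4 t : ℝ) := by
  obtain ⟨X, B, Y, hX, hB, hY, hX', hB', hY'⟩ := C.exists_chord_factors
  have hpos := fun t h hh => C.chord_factor_pos hX' hX hY' t (h := h) hh
  refine ⟨_, isSmoothHolomorphic_kernelFactor C.contDiff_tanTan hB hX hY hpos,
    fun s t h h0 hL => C.layerKernel_chord hX' hB' hY' s t h0 (hpos t h ⟨by linarith, hL⟩),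
    fun t => ?_⟩
  have slice : ∀ {φ : ℝ × ℝ → ℝ}, ContDiff ℝ ∞ φ → ContDiff ℝ ∞ fun h => φ (t, h) := fun h =>
    h.comp (contDiff_prodMk_right t)
  have key := kernelFactor_coeff (κ := fun h => C.curvature (t + h)) (k := fun n => (C.κ n t : ℂ))
    (C.contDiff_curvature.comp (contDiff_const.add contDiff_id)) (slice C.contDiff_tanTan)
    (slice hB) (slice hX) (slice hY) (C.tanTan_zero t)
    (fun h => by simpa only [hB'] using C.hasDerivAt_tanTan t h)
    (fun h => by simpa only [hB'] using C.hasDerivAt_norTan t h)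
    (fun h => by simpa only [hX'] using C.hasDerivAt_tanChord t h)
    (fun h => by simpa only [hB', hY'] using C.hasDerivAt_norChord t h)
    (fun n => by rw [iteratedDeriv_comp_const_add]; simp [κ])
  push_cast
  exact key

end SmoothClosedCurve

/-! ### Derivatives of complex powers of the norm, including at the origin. -/

section NormPower

/-- The complex valued linear form `w ↦ ⟨x, w⟩`. -/
noncomputable def innerForm (x : Plane) : Plane →L[ℝ] ℂ := Complex.ofRealCLM.comp (innerSL ℝ x)

theorem innerForm_apply (x w : Plane) : innerForm x w = (inner ℝ x w : ℝ) := rfl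

theorem continuous_innerForm : Continuous innerForm :=
  continuous_const.clm_comp (innerSL ℝ).continuous

theorem norm_innerForm_le (x : Plane) : ‖innerForm x‖ ≤ ‖x‖ := by
  refine ContinuousLinearMap.opNorm_le_bound _ (norm_nonneg _) fun w => ?_
  rw [innerForm_apply, Complex.norm_real]
  exact norm_inner_le_norm x w

theorem ofReal_sq_cpow_half {r : ℝ} (hr : 0 < r) (w : ℂ) :
    ((r ^ 2 : ℝ) : ℂ) ^ (w / 2) = (r : ℂ) ^ w := by
  rw [sq, Complex.ofReal_mul, Complex.mul_cpow_ofReal_nonneg hr.le hr.le,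
    ← Complex.cpow_add _ _ (by exact_mod_cast hr.ne'), add_halves]

/-- The power is written as `(‖x‖²)^(w/2)`, since the squared norm has a simple derivative. -/
theorem hasFDerivAt_norm_cpow {x : Plane} (hx : x ≠ 0) (w : ℂ) :
    HasFDerivAt (fun x : Plane => (‖x‖ : ℂ) ^ w) ((w * (‖x‖ : ℂ) ^ (w - 2)) • innerForm x) x := by
  have hpos : 0 < ‖x‖ := norm_pos_iff.2 hx
  have h1 : HasFDerivAt (fun x : Plane => ‖x‖ ^ 2) (2 • innerSL ℝ x) x :=
    (hasStrictFDerivAt_norm_sq x).hasFDerivAt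
  have h2 : HasFDerivAt (fun x : Plane => ((‖x‖ ^ 2 : ℝ) : ℂ))
      (Complex.ofRealCLM.comp (2 • innerSL ℝ x)) x := Complex.ofRealCLM.hasFDerivAt.comp x h1
  have h3 : HasDerivAt (fun z : ℂ => z ^ (w / 2)) (w / 2 * ((‖x‖ ^ 2 : ℝ) : ℂ) ^ (w / 2 - 1))
      ((‖x‖ ^ 2 : ℝ) : ℂ) := by
    have := (hasDerivAt_id ((‖x‖ ^ 2 : ℝ) : ℂ)).cpow_const (c := w / 2)
      (Or.inl (by rw [id, Complex.ofReal_re]; positivity))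
    simpa using this
  have h4 := h3.comp_hasFDerivAt x h2
  have e : (w / 2 - 1) = (w - 2) / 2 := by ring
  rw [e, ofReal_sq_cpow_half hpos] at h4
  have h5 : HasFDerivAt (fun x : Plane => (‖x‖ : ℂ) ^ w)
      ((w / 2 * (‖x‖ : ℂ) ^ (w - 2)) • Complex.ofRealCLM.comp (2 • innerSL ℝ x)) x := by
    refine h4.congr_of_eventuallyEq ?_
    filter_upwards [isOpen_ne.mem_nhds hx] with y hy
    exact (ofReal_sq_cpow_half (norm_pos_iff.2 hy) w).symm
  refine h5.congr_fderiv ?_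
  ext v
  simp [innerForm]
  ring

theorem hasFDerivAt_zero_of_norm_le {f : Plane → ℂ} {c p : ℝ} (hp : 1 < p)
    (hf : ∀ x, ‖f x‖ ≤ c * ‖x‖ ^ p) : HasFDerivAt f (0 : Plane →L[ℝ] ℂ) 0 := by
  have hf0 : f 0 = 0 := by
    have := hf 0
    rw [norm_zero, Real.zero_rpow (by linarith), mul_zero] at this
    exact norm_le_zero_iff.1 this
  refine HasFDerivAt.of_isLittleO ?_
  simp only [hf0, sub_zero, zero_apply]
  rw [Asymptotics.isLittleO_iff]
  intro ε hε
  have hlim : Tendsto (fun x : Plane => c * ‖x‖ ^ (p - 1)) (𝓝 0) (𝓝 0) := by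
    have h1 : ContinuousAt (fun x : Plane => c * ‖x‖ ^ (p - 1)) 0 :=
      continuousAt_const.mul (continuous_norm.continuousAt.rpow_const (Or.inr (by linarith)))
    have := h1.tendsto
    simpa [Real.zero_rpow (show p - 1 ≠ 0 by linarith)] using this
  filter_upwards [hlim.eventually (gt_mem_nhds hε)] with x hx
  refine (hf x).trans ?_
  rcases eq_or_ne x 0 with rfl | hx0
  · simp [Real.zero_rpow (show p ≠ 0 by linarith)]
  · have hpos : 0 < ‖x‖ := norm_pos_iff.2 hx0
    have : ‖x‖ ^ p = ‖x‖ ^ (p - 1) * ‖x‖ := by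
      rw [← Real.rpow_add_one hpos.ne', sub_add_cancel]
    rw [this, ← mul_assoc]
    exact mul_le_mul_of_nonneg_right hx.le hpos.le

theorem norm_norm_cpow {x : Plane} {w : ℂ} (hw : 0 < w.re) :
    ‖(‖x‖ : ℂ) ^ w‖ = ‖x‖ ^ w.re :=
  Complex.norm_cpow_eq_rpow_re_of_nonneg (norm_nonneg x) hw.ne'

theorem hasFDerivAt_normPow {s : ℂ} (hs : 2 < s.re) (x : Plane) :
    HasFDerivAt (normPow s) ((s * (‖x‖ : ℂ) ^ (s - 2)) • innerForm x) x := by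
  rcases eq_or_ne x 0 with rfl | hx
  · have h : HasFDerivAt (normPow s) (0 : Plane →L[ℝ] ℂ) 0 :=
      hasFDerivAt_zero_of_norm_le (c := 1) (p := s.re) (by linarith) fun x => by
        rw [normPow, norm_norm_cpow (by linarith), one_mul]
    refine h.congr_fderiv ?_
    ext w
    simp [innerForm_apply]
  · exact hasFDerivAt_norm_cpow hx s

/-- The derivative at `x` of `x ↦ s ‖x‖^(s-2) ⟨x, m⟩`. -/
noncomputable def layerForm (s : ℂ) (x m : Plane) : Plane →L[ℝ] ℂ :=
  (s * (‖x‖ : ℂ) ^ (s - 2)) • innerForm m +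
    (s * (s - 2) * ((‖x‖ : ℂ) ^ (s - 4) * (inner ℝ x m : ℝ))) • innerForm x

theorem layerForm_apply (s : ℂ) (x m n : Plane) : layerForm s x m n = -layerKernel s n m x := by
  simp only [layerForm, layerKernel, innerForm_apply, add_apply, smul_apply, smul_eq_mul,
    real_inner_comm n m]
  ring

/-- At the origin the function is bounded by a constant times `‖x‖^(Re s - 1)`, of exponent greater
than 1, so its derivative is 0; this is where `Re s > 2` is needed. -/
theorem hasFDerivAt_layer {s : ℂ} (hs : 2 < s.re) (x m : Plane) :
    HasFDerivAt (fun x : Plane => s * (‖x‖ : ℂ) ^ (s - 2) * (inner ℝ x m : ℝ))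
      (layerForm s x m) x := by
  have hs2 : 0 < (s - 2).re := by simpa using hs
  rcases eq_or_ne x 0 with rfl | hx
  · have e : layerForm s 0 m = 0 := by
      ext w
      have : s - 2 ≠ 0 := fun h => by simp [h] at hs2
      simp [layerForm, Complex.zero_cpow this]
    rw [e]
    refine hasFDerivAt_zero_of_norm_le (c := ‖s‖ * ‖m‖) (p := (s - 2).re + 1) (by linarith)
      fun x => ?_
    rw [norm_mul, norm_mul, norm_norm_cpow hs2, Complex.norm_real]
    have h1 : ‖(inner ℝ x m : ℝ)‖ ≤ ‖x‖ * ‖m‖ := norm_inner_le_norm x m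
    have h2 : ‖x‖ ^ ((s - 2).re + 1) = ‖x‖ ^ (s - 2).re * ‖x‖ := by
      rw [Real.rpow_add_one' (norm_nonneg x) (by linarith)]
    rw [h2]
    calc ‖s‖ * ‖x‖ ^ (s - 2).re * ‖(inner ℝ x m : ℝ)‖
        ≤ ‖s‖ * ‖x‖ ^ (s - 2).re * (‖x‖ * ‖m‖) := by gcongr
      _ = _ := by ring
  · have h1 := (hasFDerivAt_norm_cpow hx (s - 2)).const_mul s
    have h2 : HasFDerivAt (fun x : Plane => ((inner ℝ x m : ℝ) : ℂ)) (innerForm m) x := by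
      have : (fun x : Plane => ((inner ℝ x m : ℝ) : ℂ)) = innerForm m := by
        ext y
        rw [innerForm_apply, real_inner_comm]
      rw [this]
      exact (innerForm m).hasFDerivAt
    refine (h1.mul h2).congr_fderiv ?_
    have e : s - 2 - 2 = s - 4 := by ring
    ext w
    simp only [layerForm, e, add_apply, smul_apply, smul_eq_mul]
    ring

theorem continuous_layerForm {s : ℂ} (hs : 2 < s.re) :
    Continuous fun p : Plane × Plane => layerForm s p.1 p.2 := by
  have hs2 : 0 < (s - 2).re := by simpa using hs
  have hcpow : Continuous fun p : Plane × Plane => (‖p.1‖ : ℂ) ^ (s - 2) :=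
    (Complex.continuous_ofReal_cpow_const hs2).comp continuous_fst.norm
  refine ((continuous_const.mul hcpow).smul (continuous_innerForm.comp continuous_snd)).add ?_
  rw [continuous_iff_continuousAt]
  rintro ⟨x, m⟩
  rcases eq_or_ne x 0 with rfl | hx
  -- For `Re s < 4` the factor `‖x‖^(s-4)` blows up at the origin, but the two factors linear in `x`
  -- leave a bound of order `‖x‖^(Re s - 2)`.
  · have h0 : innerForm 0 = 0 := by
      ext w
      simp [innerForm_apply]
    have hlim : Tendsto (fun p : Plane × Plane => ‖s * (s - 2)‖ * (‖p.1‖ ^ (s - 2).re * ‖p.2‖))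
        (𝓝 (0, m)) (𝓝 0) := by
      have h1 : ContinuousAt (fun p : Plane × Plane =>
          ‖s * (s - 2)‖ * (‖p.1‖ ^ (s - 2).re * ‖p.2‖)) (0, m) :=
        continuousAt_const.mul ((continuous_fst.norm.continuousAt.rpow_const
          (Or.inr hs2.le)).mul continuous_snd.norm.continuousAt)
      have := h1.tendsto
      simpa only [norm_zero, Real.zero_rpow hs2.ne', zero_mul, mul_zero] using this
    have hzero : Tendsto (fun p : Plane × Plane =>
        (s * (s - 2) * ((‖p.1‖ : ℂ) ^ (s - 4) * (inner ℝ p.1 p.2 : ℝ))) • innerForm p.1)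
        (𝓝 (0, m)) (𝓝 0) := by
      refine squeeze_zero_norm (fun p => ?_) hlim
      rw [norm_smul, norm_mul, norm_mul _ (((inner ℝ p.1 p.2 : ℝ) : ℂ)), Complex.norm_real]
      rcases eq_or_ne p.1 0 with hp | hp
      · rw [hp, h0]
        simp only [norm_zero, mul_zero]
        positivity
      · have hpos : 0 < ‖p.1‖ := norm_pos_iff.2 hp
        have h1 : ‖(inner ℝ p.1 p.2 : ℝ)‖ ≤ ‖p.1‖ * ‖p.2‖ := norm_inner_le_norm _ _
        have h2 := norm_innerForm_le p.1
        have h3 : ‖(‖p.1‖ : ℂ) ^ (s - 4)‖ = ‖p.1‖ ^ (s - 4).re :=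
          Complex.norm_cpow_eq_rpow_re_of_pos hpos _
        have h4 : ‖p.1‖ ^ (s - 2).re = ‖p.1‖ ^ (s - 4).re * ‖p.1‖ ^ 2 := by
          rw [← Real.rpow_natCast, ← Real.rpow_add hpos]
          congr 1
          simp
          ring
        rw [h3, h4]
        calc ‖s * (s - 2)‖ * (‖p.1‖ ^ (s - 4).re * ‖(inner ℝ p.1 p.2 : ℝ)‖) * ‖innerForm p.1‖
            ≤ ‖s * (s - 2)‖ * (‖p.1‖ ^ (s - 4).re * (‖p.1‖ * ‖p.2‖)) * ‖p.1‖ := by gcongr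
          _ = _ := by ring
    rw [ContinuousAt]
    convert hzero using 2
    ext w
    simp [h0]
  · have hne : (‖x‖ : ℝ) ≠ 0 := norm_ne_zero_iff.2 hx
    have h1 : ContinuousAt (fun p : Plane × Plane => (‖p.1‖ : ℂ) ^ (s - 4)) (x, m) :=
      ContinuousAt.comp (g := fun r : ℝ => (r : ℂ) ^ (s - 4))
        (f := fun p : Plane × Plane => ‖p.1‖)
        (Complex.continuousAt_ofReal_cpow_const ‖x‖ (s - 4) (Or.inr hne))
        (continuous_fst.norm.continuousAt (x := (x, m)))
    have h2 : ContinuousAt (fun p : Plane × Plane => ((inner ℝ p.1 p.2 : ℝ) : ℂ)) (x, m) :=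
      (Complex.continuous_ofReal.comp (Continuous.inner (𝕜 := ℝ) continuous_fst
        continuous_snd)).continuousAt
    have h3 : ContinuousAt (fun p : Plane × Plane => innerForm p.1) (x, m) :=
      (continuous_innerForm.comp continuous_fst).continuousAt
    have h4 : ContinuousAt (fun p : Plane × Plane =>
        s * (s - 2) * ((‖p.1‖ : ℂ) ^ (s - 4) * (inner ℝ p.1 p.2 : ℝ))) (x, m) :=
      continuousAt_const.mul (h1.mul h2)
    exact h4.smul h3

theorem continuous_layerKernel {s : ℂ} (hs : 2 < s.re) {T : Type*} [TopologicalSpace T]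
    {n m x : T → Plane} (hn : Continuous n) (hm : Continuous m) (hx : Continuous x) :
    Continuous fun t => layerKernel s (n t) (m t) (x t) := by
  have h := ((continuous_layerForm hs).comp (hx.prodMk hm)).clm_apply hn
  simp only [Function.comp_def, layerForm_apply] at h
  exact h.neg.congr fun t => neg_neg _

end NormPower

/-! ### The beta function as a sum of double integrals. -/

section DoubleLayer

variable {ι : Type*} {C : ι → SmoothClosedCurve} {ν : Plane → Plane}

theorem IsUnitNormalField.continuous_comp (hν : IsUnitNormalField C ν) (i : ι) :
    Continuous fun t => ν ((C i).γ t) :=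
  hν.continuousOn.comp_continuous (C i).smooth.continuous fun t =>
    mem_iUnion.2 ⟨i, mem_range_self t⟩

theorem fderiv_normPow_sub {s : ℂ} (hs : 2 < s.re) (u v n : Plane) :
    fderiv ℝ (fun v => normPow s (v - u)) v n =
      s * (‖v - u‖ : ℂ) ^ (s - 2) * (inner ℝ (v - u) n : ℝ) := by
  have h : HasFDerivAt (fun v => normPow s (v - u)) _ v :=
    HasFDerivAt.comp (g := normPow s) (f := fun v => v - u) v (hasFDerivAt_normPow hs (v - u))
      ((hasFDerivAt_id v).sub_const u)
  rw [h.fderiv]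
  simp [innerForm_apply]

theorem continuous_layer {s : ℂ} (hs : 2 < s.re) {T : Type*} [TopologicalSpace T]
    {m x : T → Plane} (hm : Continuous m) (hx : Continuous x) :
    Continuous fun t => s * (‖x t‖ : ℂ) ^ (s - 2) * (inner ℝ (x t) (m t) : ℝ) := by
  have hs2 : 0 < (s - 2).re := by simpa using hs
  exact (continuous_const.mul ((Complex.continuous_ofReal_cpow_const hs2).comp hx.norm)).mul
    (Complex.continuous_ofReal.comp (hx.inner hm))

variable [Fintype ι]

theorem fderiv_doubleLayer_normPow (hν : IsUnitNormalField C ν) {s : ℂ} (hs : 2 < s.re)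
    (u n : Plane) :
    fderiv ℝ (fun u => doubleLayer C ν fun v => normPow s (v - u)) u n =
      ∑ j, ∫ τ in (0 : ℝ)..(C j).L, layerKernel s n (ν ((C j).γ τ)) ((C j).γ τ - u) := by
  have hcont : ∀ j, Continuous fun p : Plane × ℝ =>
      layerForm s ((C j).γ p.2 - p.1) (ν ((C j).γ p.2)) := fun j =>
    Continuous.comp (g := fun p : Plane × Plane => layerForm s p.1 p.2)
      (f := fun p : Plane × ℝ => ((C j).γ p.2 - p.1, ν ((C j).γ p.2))) (continuous_layerForm hs)
      ((((C j).smooth.continuous.comp continuous_snd).sub continuous_fst).prodMk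
        ((hν.continuous_comp j).comp continuous_snd))
  have hj : ∀ j, HasFDerivAt (fun u => ∫ τ in (0 : ℝ)..(C j).L,
      s * (‖(C j).γ τ - u‖ : ℂ) ^ (s - 2) * (inner ℝ ((C j).γ τ - u) (ν ((C j).γ τ)) : ℝ))
      (∫ τ in (0 : ℝ)..(C j).L, -layerForm s ((C j).γ τ - u) (ν ((C j).γ τ))) u := fun j => by
    refine hasFDerivAt_intervalIntegral_of_continuousOn isOpen_univ
      (f' := fun u τ => -layerForm s ((C j).γ τ - u) (ν ((C j).γ τ))) (fun u _ => ?_)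
      (hcont j).neg.continuousOn (fun u _ τ _ => ?_) (mem_univ u)
    · exact (continuous_layer hs (hν.continuous_comp j)
        ((C j).smooth.continuous.sub continuous_const)).continuousOn
    · have h := (hasFDerivAt_layer hs ((C j).γ τ - u) (ν ((C j).γ τ))).comp u
        ((hasFDerivAt_id u).const_sub ((C j).γ τ))
      refine h.congr_fderiv ?_
      ext w
      simp
  have hsum := HasFDerivAt.fun_sum (u := Finset.univ) fun j _ => hj j
  have e : (fun u => doubleLayer C ν fun v => normPow s (v - u)) = fun u => ∑ j,
      ∫ τ in (0 : ℝ)..(C j).L, s * (‖(C j).γ τ - u‖ : ℂ) ^ (s - 2) *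
        (inner ℝ ((C j).γ τ - u) (ν ((C j).γ τ)) : ℝ) := by
    ext u
    simp only [doubleLayer, SmoothClosedCurve.arcIntegral, fderiv_normPow_sub hs]
  rw [e, hsum.fderiv, sum_apply]
  refine Finset.sum_congr rfl fun j _ => ?_
  rw [ContinuousLinearMap.intervalIntegral_apply]
  · simp [layerForm_apply]
  · exact ((hcont j).comp (Continuous.prodMk_right u)).neg.intervalIntegrable _ _

/-- The interaction of two boundary components. -/
noncomputable def layerIntegral (C : ι → SmoothClosedCurve) (ν : Plane → Plane) (i j : ι)
    (s : ℂ) : ℂ :=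
  ∫ t in (0 : ℝ)..(C i).L, ∫ τ in (0 : ℝ)..(C j).L,
    layerKernel s (ν ((C i).γ t)) (ν ((C j).γ τ)) ((C j).γ τ - (C i).γ t)

theorem brylinskiBeta_doubleLayer (hν : IsUnitNormalField C ν) {s : ℂ} (hs : 2 < s.re) :
    brylinskiBeta (doubleLayer C ν) s = ∑ i, ∑ j, layerIntegral C ν i j s := by
  have key : brylinskiBeta (doubleLayer C ν) s = ∑ i, ∫ t in (0 : ℝ)..(C i).L,
      fderiv ℝ (fun u => doubleLayer C ν fun v => normPow s (v - u)) ((C i).γ t)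
        (ν ((C i).γ t)) := rfl
  rw [key]
  refine Finset.sum_congr rfl fun i _ => ?_
  simp only [fderiv_doubleLayer_normPow hν hs]
  rw [intervalIntegral.integral_finsetSum]
  · rfl
  · intro j _
    refine Continuous.intervalIntegrable ?_ _ _
    refine intervalIntegral.continuous_parametric_intervalIntegral_of_continuous' ?_ _ _
    exact continuous_layerKernel hs ((hν.continuous_comp i).comp continuous_fst)
      ((hν.continuous_comp j).comp continuous_snd)
      (((C j).smooth.continuous.comp continuous_snd).sub
        ((C i).smooth.continuous.comp continuous_fst))

end DoubleLayer

/-! ### Reduction to the diagonal, and self-interaction of one component. -/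

theorem integral_periodic_symmetric_kernel {k : ℝ → ℝ → ℂ} {L : ℝ}
    (hk : Continuous (Function.uncurry k)) (h1 : ∀ t τ, k (t + L) τ = k t τ)
    (h2 : ∀ t τ, k t (τ + L) = k t τ) (hsymm : ∀ t τ, k t τ = k τ t) :
    ∫ t in (0 : ℝ)..L, ∫ τ in (0 : ℝ)..L, k t τ =
      2 * ∫ h in (0 : ℝ)..L / 2, ∫ t in (0 : ℝ)..L, k t (t + h) := by
  have hcomp : ∀ {f g : ℝ × ℝ → ℝ}, Continuous f → Continuous g →
      Continuous fun p : ℝ × ℝ => k (f p) (g p) := fun hf hg => hk.comp (hf.prodMk hg)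
  have hslice : ∀ {f g : ℝ → ℝ}, Continuous f → Continuous g →
      Continuous fun t => k (f t) (g t) := fun hf hg => hk.comp (hf.prodMk hg)
  have hshift : ∀ t, ∫ τ in (0 : ℝ)..L, k t τ = ∫ h in (0 : ℝ)..L, k t (t + h) := fun t => by
    rw [intervalIntegral.integral_comp_add_left (fun τ => k t τ) t, add_zero]
    have hp : Function.Periodic (fun τ => k t τ) L := h2 t
    have := hp.intervalIntegral_add_eq 0 t
    rwa [zero_add] at this
  -- On a closed curve both `h = 0` and `h = L` are on the diagonal. The substitution `h ↦ L - h` on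
  -- the second half moves the end `h = L` to 0.
  have hsplit : ∀ t, ∫ h in (0 : ℝ)..L, k t (t + h) =
      (∫ h in (0 : ℝ)..L / 2, k t (t + h)) + ∫ h in (0 : ℝ)..L / 2, k t (t - h) := fun t => by
    have hc : Continuous fun h => k t (t + h) := hslice continuous_const (by fun_prop)
    rw [← intervalIntegral.integral_add_adjacent_intervals (b := L / 2)
      (hc.intervalIntegrable _ _) (hc.intervalIntegrable _ _)]
    congr 1
    have h3 := intervalIntegral.integral_comp_sub_left (a := 0) (b := L / 2)
      (fun h => k t (t + h)) L
    rw [sub_zero, sub_half] at h3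
    rw [← h3]
    refine intervalIntegral.integral_congr fun h _ => ?_
    rw [← h2 t (t - h)]
    congr 1
    ring
  have hint1 : Continuous fun t => ∫ h in (0 : ℝ)..L / 2, k t (t + h) :=
    intervalIntegral.continuous_parametric_intervalIntegral_of_continuous'
      (f := fun t h => k t (t + h)) (hcomp continuous_fst (by fun_prop)) _ _
  have hint2 : Continuous fun t => ∫ h in (0 : ℝ)..L / 2, k t (t - h) :=
    intervalIntegral.continuous_parametric_intervalIntegral_of_continuous'
      (f := fun t h => k t (t - h)) (hcomp continuous_fst (by fun_prop)) _ _
  have hswap : ∀ {g : ℝ → ℝ → ℂ}, Continuous (Function.uncurry g) →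
      ∫ t in (0 : ℝ)..L, ∫ h in (0 : ℝ)..L / 2, g t h =
        ∫ h in (0 : ℝ)..L / 2, ∫ t in (0 : ℝ)..L, g t h := fun hg =>
    intervalIntegral_intervalIntegral_swap
      ((hg.continuousOn.integrableOn_compact (isCompact_uIcc.prod isCompact_uIcc)).mono_set
        (prod_mono uIoc_subset_uIcc uIoc_subset_uIcc))
  -- Translating `t` by `h` gives `k (t + h) t`, and symmetry identifies the two halves.
  have hback : ∀ h, ∫ t in (0 : ℝ)..L, k t (t - h) = ∫ t in (0 : ℝ)..L, k t (t + h) := fun h => by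
    have hp : Function.Periodic (fun t => k t (t - h)) L := fun t => by
      simp only
      rw [h1, show t + L - h = t - h + L by ring, h2]
    have h3 := hp.intervalIntegral_add_eq 0 h
    rw [zero_add] at h3
    have h4 := intervalIntegral.integral_comp_add_left (a := 0) (b := L)
      (fun t => k t (t - h)) h
    rw [add_zero] at h4
    rw [h3, ← h4]
    refine intervalIntegral.integral_congr fun t _ => ?_
    rw [hsymm, add_sub_cancel_left, add_comm h t]
  simp only [hshift, hsplit]
  rw [intervalIntegral.integral_add (hint1.intervalIntegrable _ _)
    (hint2.intervalIntegrable _ _), hswap (g := fun t h => k t (t + h))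
      (hcomp continuous_fst (by fun_prop)), hswap (g := fun t h => k t (t - h))
      (hcomp continuous_fst (by fun_prop))]
  simp only [hback]
  ring

/-- The component of `ν` along the rotated tangent is continuous with square 1, hence constant on
the connected parameter line. -/
theorem IsUnitNormalField.exists_sign {ι : Type*} {C : ι → SmoothClosedCurve} {ν : Plane → Plane}
    (hν : IsUnitNormalField C ν) (i : ι) :
    ∃ c : ℝ, c * c = 1 ∧ ∀ t, ν ((C i).γ t) = c • (C i).normal t := by
  have hcoord : ∀ j : Fin 2, Continuous fun t => ν ((C i).γ t) j := fun j =>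
    (EuclideanSpace.proj j : Plane →L[ℝ] ℝ).continuous.comp (hν.continuous_comp i)
  have hvel := fun j => ((C i).contDiff_vel j).continuous
  let σ : ℝ → ℝ := fun t =>
    (C i).vel 0 t * ν ((C i).γ t) 1 - (C i).vel 1 t * ν ((C i).γ t) 0
  have hσ : Continuous σ :=
    ((hvel 0).mul (hcoord 1)).sub ((hvel 1).mul (hcoord 0))
  have horth : ∀ t, ν ((C i).γ t) 0 * (C i).vel 0 t + ν ((C i).γ t) 1 * (C i).vel 1 t = 0 :=
    fun t => by
      have := hν.normal i t
      rwa [Plane.inner_eq] at this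
  have hunit : ∀ t, ν ((C i).γ t) 0 ^ 2 + ν ((C i).γ t) 1 ^ 2 = 1 := fun t => by
    rw [← Plane.norm_sq_eq, hν.norm_eq_one, one_pow]
  have hsq : ∀ t, σ t ^ 2 = 1 := fun t => by
    linear_combination (ν ((C i).γ t) 0 ^ 2 + ν ((C i).γ t) 1 ^ 2) * (C i).vel_sq t
      + hunit t - (ν ((C i).γ t) 0 * (C i).vel 0 t + ν ((C i).γ t) 1 * (C i).vel 1 t) * horth t
  have hrep : ∀ t, ν ((C i).γ t) = σ t • (C i).normal t := fun t => by
    ext j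
    fin_cases j
    · simp [SmoothClosedCurve.normal, σ]
      linear_combination (-ν ((C i).γ t) 0) * (C i).vel_sq t + (C i).vel 0 t * horth t
    · simp [SmoothClosedCurve.normal, σ]
      linear_combination (-ν ((C i).γ t) 1) * (C i).vel_sq t + (C i).vel 1 t * horth t
  have hconst := isPreconnected_univ.eq_or_eq_neg_of_sq_eq (f := σ) (g := fun _ => (1 : ℝ))
    hσ.continuousOn continuousOn_const (fun t _ => by simp [hsq t]) (fun _ => one_ne_zero)
  rcases hconst with h | h
  · refine ⟨1, by norm_num, fun t => ?_⟩
    rw [hrep t, h (mem_univ t)]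
  · refine ⟨-1, by norm_num, fun t => ?_⟩
    rw [hrep t, h (mem_univ t)]
    rfl

namespace SmoothClosedCurve

variable (C : SmoothClosedCurve)

theorem normal_periodic : Function.Periodic C.normal C.L := fun t => by
  have : ∀ i, C.vel i (t + C.L) = C.vel i t := fun i => by
    have h : deriv C.γ (t + C.L) = deriv C.γ t := by
      rw [← deriv_comp_add_const]
      exact congrArg (fun f => deriv f t) (funext C.periodic)
    rw [vel, h, vel]
  rw [normal, this, this, normal]

theorem continuous_normal : Continuous C.normal := by
  have h : ContDiff ℝ ∞ C.normal := by
    refine contDiff_euclidean.2 fun i => ?_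
    fin_cases i
    · simpa [normal] using (C.contDiff_vel 1).neg
    · simpa [normal] using C.contDiff_vel 0
  exact h.continuous

/-- Self-interaction of one boundary component: continuation and residues. -/
theorem exists_meromorphic_selfIntegral : ∃ F : ℂ → ℂ, Meromorphic F ∧
    (∀ s : ℂ, 2 < s.re → F s = ∫ t in (0 : ℝ)..C.L, ∫ τ in (0 : ℝ)..C.L,
      layerKernel s (C.normal t) (C.normal τ) (C.γ τ - C.γ t)) ∧
    HasSimplePart F 1 ((-2 * C.L : ℝ) : ℂ) ∧
    HasSimplePart F (-1) ((C.arcIntegral fun t => 3 / 4 * C.κ 0 t ^ 2 : ℝ) : ℂ) ∧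
    HasSimplePart F (-3) ((C.arcIntegral fun t => 45 / 64 * C.κ 0 t ^ 4 + 5 / 4 * C.κ 1 t ^ 2
      + 15 / 8 * C.κ 0 t * C.κ 2 t : ℝ) : ℂ) ∧
    HasSimplePart F (-5) ((C.arcIntegral fun t =>
      175 / 512 * C.κ 0 t ^ 6 + 1295 / 288 * C.κ 0 t ^ 2 * C.κ 1 t ^ 2
        + 1085 / 576 * C.κ 0 t ^ 3 * C.κ 2 t + 175 / 576 * C.κ 2 t ^ 2
        + 35 / 72 * C.κ 1 t * C.κ 3 t + 35 / 144 * C.κ 0 t * C.κ 4 t : ℝ) : ℂ) := by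
  obtain ⟨f, hf, hker, hcoef⟩ := C.exists_smooth_factor
  have hL := C.L_pos
  obtain ⟨F, hFm, hF, hFres⟩ := exists_meromorphic_mellin (hf.isHolomorphicJet C.L)
    (half_pos hL) (half_lt_self hL)
  -- The factor 2 comes from folding; the coefficient of the integrated jet is the integral of the
  -- Taylor coefficients.
  have hres : ∀ (k : ℕ) (z : ℂ) (g : ℝ → ℝ), z = 1 - k →
      (∀ t, 2 * taylorCoeff (fun h => f (z, t, h)) k = (g t : ℂ)) →
      HasSimplePart (fun s => 2 * F s) z ((C.arcIntegral g : ℝ) : ℂ) := by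
    rintro k z g rfl hg
    convert (hFres k).const_mul 2 using 1
    rw [arcIntegral, ← intervalIntegral.integral_ofReal, integratedJet,
      ← intervalIntegral.integral_div, ← intervalIntegral.integral_const_mul]
    refine intervalIntegral.integral_congr fun t _ => ?_
    rw [← hg, hf.iterate_derivLast_eq k _ t (h := 0) ⟨by linarith, hL⟩, taylorCoeff]
  refine ⟨fun s => 2 * F s, fun s => (MeromorphicAt.const 2 s).mul (hFm s), fun s hs => ?_,
    ?_, hres 2 (-1) _ (by norm_num) fun t => (hcoef t).2.1,
    hres 4 (-3) _ (by norm_num) fun t => (hcoef t).2.2.1,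
    hres 6 (-5) _ (by norm_num) fun t => (hcoef t).2.2.2⟩
  · simp only
    rw [hF s hs, integral_periodic_symmetric_kernel (k := fun t τ =>
      layerKernel s (C.normal t) (C.normal τ) (C.γ τ - C.γ t))]
    · congr 1
      refine intervalIntegral.integral_congr fun h hh => ?_
      rw [uIcc_of_le (half_pos hL).le] at hh
      rw [integratedJet, ← intervalIntegral.integral_const_mul]
      refine intervalIntegral.integral_congr fun t _ => ?_
      simp only [Function.iterate_zero, id]
      -- The factorization holds only for `h > 0`; at the endpoint both sides vanish because
      -- `0^(s-2) = 0`.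
      rcases hh.1.eq_or_lt with h0 | h0
      · have hne : s - 2 ≠ 0 := fun h => by
          have := congrArg Complex.re h
          simp at this
          linarith
        rw [← h0]
        simp [layerKernel, Complex.zero_cpow hne]
      · exact (hker s t h h0 (by linarith [hh.2])).symm
    · exact continuous_layerKernel hs (C.continuous_normal.comp continuous_fst)
        (C.continuous_normal.comp continuous_snd) ((C.smooth.continuous.comp continuous_snd).sub
          (C.smooth.continuous.comp continuous_fst))
    · intro t τ
      rw [C.normal_periodic, C.periodic]
    · intro t τ
      rw [C.normal_periodic, C.periodic]
    · intro t τ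
      rw [← neg_sub, layerKernel_comm]
  · have := hres 0 1 (fun _ => -2) (by norm_num) fun t => by simpa using (hcoef t).1
    simpa [arcIntegral, mul_comm] using this

end SmoothClosedCurve

/-! ### Interaction of distinct components and the sum over all pairs. -/

section Assembly

variable {ι : Type*} {C : ι → SmoothClosedCurve} {ν : Plane → Plane}

theorem layerIntegral_self (hν : IsUnitNormalField C ν) (i : ι) (s : ℂ) :
    layerIntegral C ν i i s = ∫ t in (0 : ℝ)..(C i).L, ∫ τ in (0 : ℝ)..(C i).L,
      layerKernel s ((C i).normal t) ((C i).normal τ) ((C i).γ τ - (C i).γ t) := by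
  obtain ⟨c, hc, hcν⟩ := hν.exists_sign i
  simp only [layerIntegral, hcν, layerKernel_smul, hc, Complex.ofReal_one, one_mul]

theorem continuous_layerKernel_of_ne_zero {T : Type*} [TopologicalSpace T] {n m x : T → Plane}
    (hn : Continuous n) (hm : Continuous m) (hx : Continuous x) (hx0 : ∀ t, x t ≠ 0) :
    Continuous fun p : ℂ × T => layerKernel p.1 (n p.2) (m p.2) (x p.2) := by
  have hpow : ∀ c : ℂ, Continuous fun p : ℂ × T => (‖x p.2‖ : ℂ) ^ (p.1 - c) := fun c => by
    refine Continuous.cpow (Complex.continuous_ofReal.comp (hx.comp continuous_snd).norm)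
      (by fun_prop) fun p => ?_
    exact Complex.ofReal_mem_slitPlane.2 (norm_pos_iff.2 (hx0 p.2))
  have hinner : ∀ {a b : T → Plane}, Continuous a → Continuous b →
      Continuous fun p : ℂ × T => ((inner ℝ (a p.2) (b p.2) : ℝ) : ℂ) := fun ha hb =>
    Complex.continuous_ofReal.comp ((ha.comp continuous_snd).inner (hb.comp continuous_snd))
  exact (((continuous_fst.mul (hpow 2)).mul (hinner hn hm)).add
    (((continuous_fst.mul (continuous_fst.sub continuous_const)).mul (hpow 4)).mul
      ((hinner hx hn).mul (hinner hx hm)))).neg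

theorem differentiable_layerKernel (n m : Plane) {x : Plane} (hx : x ≠ 0) :
    Differentiable ℂ fun s => layerKernel s n m x := by
  have hne : (‖x‖ : ℂ) ≠ 0 := by exact_mod_cast norm_ne_zero_iff.2 hx
  have hpow : ∀ c : ℂ, Differentiable ℂ fun s : ℂ => (‖x‖ : ℂ) ^ (s - c) := fun c =>
    Differentiable.const_cpow (by fun_prop) (Or.inl hne)
  have h2 := hpow 2
  have h4 := hpow 4
  unfold layerKernel
  fun_prop

/-- The kernel is entire in `s` off the diagonal, and disjointness keeps the chord away from 0;
holomorphy then passes through the two integrals one after the other. -/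
theorem differentiable_layerIntegral (hν : IsUnitNormalField C ν) {i j : ι}
    (hdisj : Disjoint (C i).support (C j).support) :
    Differentiable ℂ (layerIntegral C ν i j) := by
  have hne : ∀ p : ℝ × ℝ, (C j).γ p.2 - (C i).γ p.1 ≠ 0 := fun p => by
    rw [sub_ne_zero]
    exact (hdisj.ne_of_mem (mem_range_self p.1) (mem_range_self p.2)).symm
  have hcont := continuous_layerKernel_of_ne_zero (T := ℝ × ℝ)
    ((hν.continuous_comp i).comp continuous_fst) ((hν.continuous_comp j).comp continuous_snd)
    (((C j).smooth.continuous.comp continuous_snd).sub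
      ((C i).smooth.continuous.comp continuous_fst)) hne
  rw [← differentiableOn_univ]
  refine differentiableOn_intervalIntegral_of_continuousOn isOpen_univ
    (Continuous.continuousOn ?_) fun t _ =>
    differentiableOn_intervalIntegral_of_continuousOn isOpen_univ
      (Continuous.continuousOn ?_) fun τ _ =>
      (differentiable_layerKernel _ _ (hne (t, τ))).differentiableOn
  · refine intervalIntegral.continuous_parametric_intervalIntegral_of_continuous'
      (X := ℂ × ℝ) (f := fun q τ => layerKernel q.1 (ν ((C i).γ q.2)) (ν ((C j).γ τ))
        ((C j).γ τ - (C i).γ q.2)) ?_ _ _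
    exact hcont.comp (f := fun r : (ℂ × ℝ) × ℝ => (r.1.1, (r.1.2, r.2))) (by fun_prop)
  · exact hcont.comp (f := fun r : ℂ × ℝ => (r.1, (t, r.2))) (by fun_prop)

theorem HasSimplePart.double_sum [Fintype ι] [DecidableEq ι] {F : ι → ι → ℂ → ℂ} {z : ℂ} {c : ι → ℝ}
    (hF : ∀ i j, HasSimplePart (F i j) z (if i = j then (c i : ℂ) else 0)) :
    HasSimplePart (fun s => ∑ i, ∑ j, F i j s) z ((∑ i, c i : ℝ) : ℂ) := by
  have h := HasSimplePart.sum Finset.univ fun i _ =>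
    HasSimplePart.sum Finset.univ fun j _ => hF i j
  simpa using h

end Assembly

theorem theorem4p1 {ι : Type*} [Fintype ι] (C : ι → SmoothClosedCurve)
    (hC : Pairwise fun i j => Disjoint (C i).support (C j).support)
    (ν : Plane → Plane) (hν : IsUnitNormalField C ν) :
    ∃ F : ℂ → ℂ, Meromorphic F ∧
      (∀ s : ℂ, 2 < s.re → F s = brylinskiBeta (doubleLayer C ν) s) ∧
      HasResidue F 1 ((-2 * ∑ i, (C i).L : ℝ) : ℂ) ∧
      HasResidue F (-1)
        ((∑ i, (C i).arcIntegral fun t => 3 / 4 * (C i).κ 0 t ^ 2 : ℝ) : ℂ) ∧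
      HasResidue F (-3)
        ((∑ i, (C i).arcIntegral fun t =>
          45 / 64 * (C i).κ 0 t ^ 4 + 5 / 4 * (C i).κ 1 t ^ 2
            + 15 / 8 * (C i).κ 0 t * (C i).κ 2 t : ℝ) : ℂ) ∧
      HasResidue F (-5)
        ((∑ i, (C i).arcIntegral fun t =>
          175 / 512 * (C i).κ 0 t ^ 6 + 1295 / 288 * (C i).κ 0 t ^ 2 * (C i).κ 1 t ^ 2
            + 1085 / 576 * (C i).κ 0 t ^ 3 * (C i).κ 2 t + 175 / 576 * (C i).κ 2 t ^ 2
            + 35 / 72 * (C i).κ 1 t * (C i).κ 3 t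
            + 35 / 144 * (C i).κ 0 t * (C i).κ 4 t : ℝ) : ℂ) := by
  classical
  choose D hDm hD h1 h2 h3 h4 using fun i => (C i).exists_meromorphic_selfIntegral
  -- Only the diagonal pairs need continuation; off the diagonal the integral itself is entire.
  let F : ι → ι → ℂ → ℂ := fun i j => if i = j then D i else layerIntegral C ν i j
  have hoff : ∀ i j, i ≠ j → ∀ z, AnalyticAt ℂ (layerIntegral C ν i j) z := fun i j hij z =>
    (differentiable_layerIntegral hν (hC hij)).analyticAt z
  have hpart : ∀ {z : ℂ} {c : ι → ℝ}, (∀ i, HasSimplePart (D i) z (c i)) →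
      ∀ i j, HasSimplePart (F i j) z (if i = j then (c i : ℂ) else 0) := by
    intro z c hc i j
    by_cases hij : i = j
    · simpa [F, hij] using hc j
    · simpa [F, hij] using (hoff i j hij z).hasSimplePart
  refine ⟨fun s => ∑ i, ∑ j, F i j s, fun s => ?_, fun s hs => ?_, ?_,
    (HasSimplePart.double_sum (hpart h2)).hasResidue,
    (HasSimplePart.double_sum (hpart h3)).hasResidue,
    (HasSimplePart.double_sum (hpart h4)).hasResidue⟩
  · refine MeromorphicAt.fun_sum fun i _ => MeromorphicAt.fun_sum fun j _ => ?_
    by_cases hij : i = j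
    · simpa [F, hij] using hDm j s
    · simpa [F, hij] using (hoff i j hij s).meromorphicAt
  · rw [brylinskiBeta_doubleLayer hν hs]
    refine Finset.sum_congr rfl fun i _ => Finset.sum_congr rfl fun j _ => ?_
    by_cases hij : i = j
    · subst hij
      simp only [F, if_true, hD i s hs, layerIntegral_self hν]
    · simp [F, hij]
  · rw [Finset.mul_sum]
    exact (HasSimplePart.double_sum (hpart h1)).hasResidue
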